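/- Let $n\ge 2$ and let $j=j_{n/2-1,1}$ be the first positive zero of the Bessel function of the first kind $J_{n/2-1}$; let $\omega_n$ be the measure of the unit ball of $\mathbb R^n$. For a bounded open set $\Omega\subset\mathbb R^n$ and $\alpha\in\mathbb R$ put $$\mu(\Omega,\alpha)=\min_{v\in W^{1,2}_0(\Omega)\setminus\{0\}}\frac{\int_\Omega|\nabla v|^2dx+\alpha\left|\int_\Omega|v|v\,dx\right|}{\int_\Omega|v|^2dx},\qquad \lambda_\Delta(\Omega)=\min_{v\in W^{1,2}_0(\Omega)\setminus\{0\}}\frac{\int_\Omega|\nabla v|^2dx}{\int_\Omega|v|^2dx},$$ and let $\lambda_T(\Omega)$ be the minimum of $\int_\Omega|\nabla v|^2dx\big/\int_\Omega|v|^2dx$ over all $v\in W^{1,2}_0(\Omega)\setminus\{0\}$ with $\int_\Omega|v|v\,dx=0$. In each of the cases below the minima that occur in the claim are attained. (1) If $B_1\subset\mathbb R^n$ is an open ball of radius $R_1>0$, then for all $\alpha\in\mathbb R$ $$\mu(B_1,\alpha)=\begin{cases}\dfrac{j^2}{R_1^2}+\alpha,&\text{if }\alpha\le\lambda_T(B_1)-\dfrac{j^2}{R_1^2},\\[2mm]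 \lambda_T(B_1),&\text{otherwise.}\end{cases}$$ (2) If $B_1,B_2\subset\mathbb R^n$ are disjoint open balls of radii $R_1\ge R_2>0$, then for all $\alpha\in\mathbb R$ $$\mu(B_1\cup B_2,\alpha)=\begin{cases}\dfrac{j^2}{R_1^2}+\alpha,&\text{if }\alpha\le\lambda_T(B_1\cup B_2)-\dfrac{j^2}{R_1^2},\\[2mm] \lambda_T(B_1\cup B_2),&\text{otherwise.}\end{cases}$$ (3) If, in (2), $R_1=R_2$ and $\Omega=B_1\cup B_2$, then for every $\alpha\ge0$ $$\mu(\Omega,\alpha)=\lambda_T(\Omega)=\lambda_\Delta(\Omega)=\frac{2^{2/n}\,\omega_n^{2/n}\,j^2}{|\Omega|^{2/n}},$$ and for every $\alpha>0$ each minimizer of $\mu(\Omega,\alpha)$ is a minimizer of $\lambda_T(\Omega)$. -/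

import Mathlib

open MeasureTheory Set Filter Topology
open scoped ContDiff Gradient ENNReal

noncomputable section

namespace TwistedEigen

/-- Euclidean space `ℝⁿ` (with the Euclidean norm and Lebesgue measure). -/
abbrev E (n : ℕ) := EuclideanSpace ℝ (Fin n)

variable {n : ℕ}

/-! ### Bessel functions of the first kind -/

/-- The Bessel function of the first kind of order `ν`, at `x > 0`, by its power series
`J_ν(x) = ∑ₘ (-1)ᵐ / (m! Γ(m + ν + 1)) (x / 2)^(2 m + ν)`. -/
def besselJ (ν x : ℝ) : ℝ :=
  ∑' m : ℕ, (-1) ^ m / ((m.factorial : ℝ) * Real.Gamma (m + ν + 1)) * (x / 2) ^ (2 * m + ν : ℝ)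

/-- The set of the positive zeros of `J_ν`. -/
def besselZeros (ν : ℝ) : Set ℝ := {x | 0 < x ∧ besselJ ν x = 0}

/-- The first positive zero `j_{ν,1}` of `J_ν`. -/
def firstBesselZero (ν : ℝ) : ℝ := sInf (besselZeros ν)

/-! ### The Sobolev space `W₀^{1,2}(Ω)` -/

/-- Test functions: smooth functions with compact support contained in `Ω`. -/
structure IsTestFunction (Ω : Set (E n)) (φ : E n → ℝ) : Prop where
  contDiff : ContDiff ℝ ∞ φ
  hasCompactSupport : HasCompactSupport φ
  tsupport_subset : tsupport φ ⊆ Ω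

/-- `g` is a weak gradient of `u` in `Ω`: both are locally integrable in `Ω` and
`∫_Ω u ∇φ = - ∫_Ω φ g` for all test functions `φ`. -/
structure IsWeakGradient (Ω : Set (E n)) (u : E n → ℝ) (g : E n → E n) : Prop where
  locallyIntegrableOn : LocallyIntegrableOn u Ω
  locallyIntegrableOn_grad : LocallyIntegrableOn g Ω
  integral_eq : ∀ φ : E n → ℝ, IsTestFunction Ω φ →
    ∫ x in Ω, u x • ∇ φ x = - ∫ x in Ω, φ x • g x

open Classical in
/-- The weak gradient of `u` in `Ω` (zero if there is none). For open `Ω` it is unique up to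
equality almost everywhere in `Ω`, see `IsWeakGradient.ae_eq`. -/
def weakGradient (Ω : Set (E n)) (u : E n → ℝ) : E n → E n :=
  if h : ∃ g, IsWeakGradient Ω u g then h.choose else 0

theorem isWeakGradient_weakGradient {Ω : Set (E n)} {u : E n → ℝ}
    (h : ∃ g, IsWeakGradient Ω u g) : IsWeakGradient Ω u (weakGradient Ω u) := by
  unfold weakGradient
  rw [dif_pos h]
  exact h.choose_spec

/-- Weak gradients in an open set are unique almost everywhere. -/
theorem IsWeakGradient.ae_eq {Ω : Set (E n)} (hΩ : IsOpen Ω) {u : E n → ℝ} {g g' : E n → E n}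
    (hg : IsWeakGradient Ω u g) (hg' : IsWeakGradient Ω u g') :
    g =ᵐ[volume.restrict Ω] g' := by
  have key : ∀ (φ : E n → ℝ) (f : E n → E n), IsTestFunction Ω φ → LocallyIntegrableOn f Ω →
      Integrable (fun x => φ x • f x) := by
    intro φ f hφ hf
    have h1 : IntegrableOn f (tsupport φ) :=
      hf.integrableOn_compact_subset hφ.tsupport_subset hφ.hasCompactSupport
    have h2 : IntegrableOn (fun x => φ x • f x) (tsupport φ) :=
      h1.continuousOn_smul hφ.contDiff.continuous.continuousOn hφ.hasCompactSupport
    refine (integrableOn_iff_integrable_of_support_subset ?_).1 h2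
    intro x hx
    refine subset_tsupport φ ?_
    intro h0
    exact hx (by simp [h0])
  have h := hΩ.ae_eq_zero_of_integral_contDiff_smul_eq_zero (μ := volume)
    (hg.locallyIntegrableOn_grad.sub hg'.locallyIntegrableOn_grad) (by
      intro φ h1 h2 h3
      have hφ : IsTestFunction Ω φ := ⟨h1, h2, h3⟩
      have e : ∀ f : E n → E n, ∫ x, φ x • f x = ∫ x in Ω, φ x • f x := by
        intro f
        refine (setIntegral_eq_integral_of_forall_compl_eq_zero ?_).symm
        intro x hx
        have : φ x = 0 := by
          by_contra h0
          exact hx (h3 (subset_tsupport φ h0))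
        simp [this]
      have i1 := key φ g hφ hg.locallyIntegrableOn_grad
      have i2 := key φ g' hφ hg'.locallyIntegrableOn_grad
      simp only [Pi.sub_apply, smul_sub]
      rw [integral_sub i1 i2, e, e, sub_eq_zero]
      have := (hg.integral_eq φ hφ).symm.trans (hg'.integral_eq φ hφ)
      exact neg_injective this)
  refine (ae_restrict_iff' hΩ.measurableSet).2 ?_
  filter_upwards [h] with x hx hxΩ
  exact sub_eq_zero.1 (by simpa using hx hxΩ)

/-- `u ∈ W^{1,2}(Ω)`: `u ∈ L²(Ω)` has a weak gradient in `Ω`, which lies in `L²(Ω)`. -/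
structure MemW12 (Ω : Set (E n)) (u : E n → ℝ) : Prop where
  memLp : MemLp u 2 (volume.restrict Ω)
  exists_weakGradient : ∃ g, IsWeakGradient Ω u g
  memLp_grad : MemLp (weakGradient Ω u) 2 (volume.restrict Ω)

/-- `u ∈ W₀^{1,2}(Ω)`: `u ∈ W^{1,2}(Ω)` is a limit, in the norm of `W^{1,2}(Ω)`, of test
functions. -/
structure MemW12Zero (Ω : Set (E n)) (u : E n → ℝ) : Prop extends MemW12 Ω u where
  exists_approx : ∃ φ : ℕ → E n → ℝ, (∀ k, IsTestFunction Ω (φ k)) ∧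
    Tendsto (fun k => eLpNorm (fun x => φ k x - u x) 2 (volume.restrict Ω)) atTop (𝓝 0) ∧
    Tendsto (fun k => eLpNorm (fun x => ∇ (φ k) x - weakGradient Ω u x) 2 (volume.restrict Ω))
      atTop (𝓝 0)

/-! ### The variational problems -/

/-- `W₀^{1,2}(Ω) \ {0}`. -/
def admissible (Ω : Set (E n)) : Set (E n → ℝ) :=
  {v | MemW12Zero Ω v ∧ ¬ v =ᵐ[volume.restrict Ω] 0}

/-- The functions of `W₀^{1,2}(Ω) \ {0}` with `∫_Ω |v| v = 0`. -/
def admissibleTwisted (Ω : Set (E n)) : Set (E n → ℝ) :=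
  {v | v ∈ admissible Ω ∧ ∫ x in Ω, |v x| * v x = 0}

/-- The Rayleigh quotient `∫_Ω |∇v|² / ∫_Ω |v|²`. -/
def rayleigh (Ω : Set (E n)) (v : E n → ℝ) : ℝ :=
  (∫ x in Ω, ‖weakGradient Ω v x‖ ^ 2) / ∫ x in Ω, |v x| ^ 2

/-- `Q(v, α) = (∫_Ω |∇v|² + α |∫_Ω |v| v|) / ∫_Ω |v|²`. -/
def Q (Ω : Set (E n)) (α : ℝ) (v : E n → ℝ) : ℝ :=
  ((∫ x in Ω, ‖weakGradient Ω v x‖ ^ 2) + α * |∫ x in Ω, |v x| * v x|) / ∫ x in Ω, |v x| ^ 2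

/-- `μ(Ω, α)`. -/
def mu (Ω : Set (E n)) (α : ℝ) : ℝ := sInf (Q Ω α '' admissible Ω)

/-- `λ_Δ(Ω)`, the first Dirichlet eigenvalue of the Laplacian. -/
def lambdaDelta (Ω : Set (E n)) : ℝ := sInf (rayleigh Ω '' admissible Ω)

/-- `λ_T(Ω)`. -/
def lambdaT (Ω : Set (E n)) : ℝ := sInf (rayleigh Ω '' admissibleTwisted Ω)

/-- `u` is a minimizer of `μ(Ω, α)`. -/
def IsMuMinimizer (Ω : Set (E n)) (α : ℝ) (u : E n → ℝ) : Prop :=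
  u ∈ admissible Ω ∧ ∀ v ∈ admissible Ω, Q Ω α u ≤ Q Ω α v

/-- `u` is a minimizer of `λ_Δ(Ω)`. -/
def IsLambdaDeltaMinimizer (Ω : Set (E n)) (u : E n → ℝ) : Prop :=
  u ∈ admissible Ω ∧ ∀ v ∈ admissible Ω, rayleigh Ω u ≤ rayleigh Ω v

/-- `u` is a minimizer of `λ_T(Ω)`. -/
def IsLambdaTMinimizer (Ω : Set (E n)) (u : E n → ℝ) : Prop :=
  u ∈ admissibleTwisted Ω ∧ ∀ v ∈ admissibleTwisted Ω, rayleigh Ω u ≤ rayleigh Ω v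

end TwistedEigen

end

/-! Write a function as `v = v⁺ - v⁻` and put `p = ∫ |v⁺|²`, `q = ∫ |v⁻|²`, so that `∫ |v| v = p -
q`. The combination `√q v⁺ - √p v⁻` satisfies the constraint and has squared norm `2pq`; testing
`λ_T` with it and the first eigenvalue `l` with `v⁺` and `v⁻` separately gives `Q ≥ min (l + α) λ_T`
(`le_of_splitting`, `IsTestFunction.le_dirichlet_add`). A nonnegative first eigenfunction has `Q = l
+ α`, a minimizer of `λ_T` has `Q = λ_T`, so the smaller value is attained; this is
`variational_problems`. It remains to find a nonnegative first eigenfunction, to see that `λ_T` is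
attained, and to see that the constraint set is not empty.

For the first eigenvalue let `H_ν` be the entire function with `J_ν(x) = (x/2)^ν H_ν((x/2)²)`, `ν =
n/2 - 1`. By the recurrence for `H_ν` the function `w(x) = H_ν(l|x - c|²/4)` solves `-Δw = l w`. As
long as `w > 0`, Picone's inequality with the field `∇w / w` bounds every Dirichlet quotient below
by `l`. With `l = j²/R²` the function `w` is positive in the ball and zero on the sphere, so its
extension by zero realizes the bound. If `H_ν` had no zero, every `l` would be a lower bound, which
is absurd; hence `j` exists. In two balls the center `c` is locally constant, so a single field,
with the eigenvalue of the larger ball, serves both.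

That `λ_T` is attained follows by the direct method: weak compactness in the closure of the pairs
`(φ, ∇φ)`, and Rellich's theorem proved by splitting the Fourier transform into low and high
frequencies. Strong `L²` convergence preserves the constraint.

For equal balls the difference of the two normalized eigenfunctions satisfies the constraint and has
quotient `j²/R²`, so `λ_T = λ_Δ`; a minimizer of `μ` with `α > 0` then cannot afford a nonzero
nonlocal term. -/

noncomputable section

namespace TwistedEigen

variable {n : ℕ}

/-! ### The power series of the Bessel function -/

/-- The `m`-th coefficient of the power series of `J_ν`. -/
def besselCoeff (ν : ℝ) (m : ℕ) : ℝ :=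
  (-1) ^ m / ((m.factorial : ℝ) * Real.Gamma (m + ν + 1))

/-- The entire function `H_ν` with `J_ν(x) = (x / 2) ^ ν * H_ν((x / 2) ^ 2)`. -/
def besselSeries (ν t : ℝ) : ℝ := ∑' m : ℕ, besselCoeff ν m * t ^ m

/-- Unit steps `Γ(z + 1) = z Γ(z)` with `z ≥ 1` are used because `Γ` is not monotone between `1` and
`2`. -/
theorem gamma_le_gamma_nat_add {ν : ℝ} (hν : 0 ≤ ν) (m : ℕ) :
    Real.Gamma (ν + 1) ≤ Real.Gamma (m + ν + 1) := by
  induction m with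
  | zero => simp
  | succ m ih =>
    have h : (0 : ℝ) < m + ν + 1 := by positivity
    have e : ((m + 1 : ℕ) : ℝ) + ν + 1 = (m + ν + 1) + 1 := by push_cast; ring
    rw [e, Real.Gamma_add_one h.ne']
    have := Real.Gamma_pos_of_pos h
    nlinarith [(Nat.cast_nonneg m : (0 : ℝ) ≤ m)]

theorem abs_besselCoeff_le {ν : ℝ} (hν : 0 ≤ ν) (m : ℕ) :
    |besselCoeff ν m| ≤ (Real.Gamma (ν + 1))⁻¹ * (m.factorial : ℝ)⁻¹ := by
  have h0 : 0 < Real.Gamma (ν + 1) := Real.Gamma_pos_of_pos (by linarith)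
  have h1 := gamma_le_gamma_nat_add hν m
  have h2 : (0 : ℝ) < m.factorial := by exact_mod_cast m.factorial_pos
  rw [besselCoeff, abs_div, abs_pow, abs_neg, abs_one, one_pow, abs_of_pos (by positivity),
    ← mul_inv, one_div, mul_comm]
  gcongr

theorem summable_besselSeries {ν : ℝ} (hν : 0 ≤ ν) (t : ℝ) :
    Summable fun m => besselCoeff ν m * t ^ m := by
  refine Summable.of_norm_bounded
    (g := fun m => (Real.Gamma (ν + 1))⁻¹ * (|t| ^ m / m.factorial))
    ((Real.summable_pow_div_factorial |t|).mul_left _) fun m => ?_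
  rw [norm_mul, norm_pow, Real.norm_eq_abs, Real.norm_eq_abs]
  calc _ ≤ (Real.Gamma (ν + 1))⁻¹ * (m.factorial : ℝ)⁻¹ * |t| ^ m := by
        gcongr; exact abs_besselCoeff_le hν m
    _ = _ := by ring

/-- Raising `m` and raising `ν` shift the argument of `Γ` alike, and `m + 1` cancels in the
factorial. This is the coefficient form of `H_ν' = -H_{ν+1}`. -/
theorem besselCoeff_succ_mul (ν : ℝ) (m : ℕ) :
    besselCoeff ν (m + 1) * ((m + 1 : ℕ) : ℝ) = -besselCoeff (ν + 1) m := by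
  have e : ((m + 1 : ℕ) : ℝ) + ν + 1 = m + (ν + 1) + 1 := by push_cast; ring
  have h2 : (m.factorial : ℝ) ≠ 0 := by exact_mod_cast m.factorial_pos.ne'
  have h3 : ((m : ℝ) + 1) ≠ 0 := by positivity
  rw [besselCoeff, besselCoeff, e, Nat.factorial_succ, pow_succ]
  push_cast
  -- For arbitrary real `ν` the argument may be a pole, where `Γ` has the value `0` and both sides
  -- vanish.
  by_cases h : Real.Gamma (m + (ν + 1) + 1) = 0
  · simp [h]
  · field_simp

/-- Termwise differentiation in the ball of radius `|t| + 1`, where the derivatives are dominated by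
the differentiated exponential series. -/
theorem hasDerivAt_besselSeries {ν : ℝ} (hν : 0 ≤ ν) (t : ℝ) :
    HasDerivAt (besselSeries ν) (-besselSeries (ν + 1) t) t := by
  set R := |t| + 1
  have key : HasDerivAt (fun y => ∑' m : ℕ, besselCoeff ν m * y ^ m)
      (∑' m : ℕ, besselCoeff ν m * (m * t ^ (m - 1))) t := by
    have hR : 0 < R := by positivity
    have ht : t ∈ Metric.ball (0 : ℝ) R := by
      rw [mem_ball_zero_iff, Real.norm_eq_abs]
      exact lt_add_one _
    refine hasDerivAt_tsum_of_isPreconnected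
      (g := fun (m : ℕ) y => besselCoeff ν m * y ^ m)
      (g' := fun (m : ℕ) y => besselCoeff ν m * (m * y ^ (m - 1)))
      (u := fun m : ℕ => (Real.Gamma (ν + 1))⁻¹ * (m.factorial : ℝ)⁻¹ * (m * R ^ (m - 1)))
      ?_ Metric.isOpen_ball (convex_ball (0 : ℝ) R).isPreconnected (fun m y _ => ?_)
      (fun m y hy => ?_) (Metric.mem_ball_self hR) (summable_besselSeries hν 0) ht
    · rw [← summable_nat_add_iff 1]
      refine ((Real.summable_pow_div_factorial R).mul_left (Real.Gamma (ν + 1))⁻¹).congr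
        fun m => ?_
      have h2 : (m.factorial : ℝ) ≠ 0 := by exact_mod_cast m.factorial_pos.ne'
      have h3 : ((m : ℝ) + 1) ≠ 0 := by positivity
      rw [Nat.factorial_succ]
      push_cast
      field_simp
    · simpa using (hasDerivAt_pow m y).const_mul (besselCoeff ν m)
    · rw [norm_mul, norm_mul, norm_pow, Real.norm_eq_abs, Real.norm_eq_abs, Real.norm_eq_abs]
      have : |y| ≤ R := by simpa using (mem_ball_zero_iff.1 hy).le
      have h0 : 0 < Real.Gamma (ν + 1) := Real.Gamma_pos_of_pos (by linarith)
      rw [Nat.abs_cast]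
      gcongr
      exact abs_besselCoeff_le hν m
  change HasDerivAt (besselSeries ν) _ t at key
  convert key using 1
  have hs : Summable fun m : ℕ => besselCoeff ν m * (m * t ^ (m - 1)) := by
    rw [← summable_nat_add_iff 1]
    refine (summable_besselSeries (by linarith : 0 ≤ ν + 1) t).neg.congr fun m => ?_
    rw [← neg_mul, ← besselCoeff_succ_mul]
    simp [mul_assoc]
  -- In the term `m = 0` the truncated exponent `m - 1` is harmless because of the factor `m`.
  rw [hs.tsum_eq_zero_add, besselSeries, ← tsum_neg]
  simp only [Nat.cast_zero, zero_mul, mul_zero, zero_add]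
  refine tsum_congr fun m => ?_
  rw [← neg_mul, ← besselCoeff_succ_mul]
  simp [mul_assoc]

/-- The derivative stays in the family `H_ν` up to sign, so the induction on the order must let `ν`
vary. -/
theorem contDiff_besselSeries {ν : ℝ} (hν : 0 ≤ ν) : ContDiff ℝ ∞ (besselSeries ν) := by
  rw [contDiff_infty]
  intro k
  induction k generalizing ν with
  | zero =>
    exact contDiff_zero.2 (continuous_iff_continuousAt.2
      fun t => (hasDerivAt_besselSeries hν t).continuousAt)
  | succ k ih =>
    push_cast
    refine contDiff_succ_iff_deriv.2
      ⟨fun t => (hasDerivAt_besselSeries hν t).differentiableAt, by simp, ?_⟩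
    have : deriv (besselSeries ν) = fun t => -besselSeries (ν + 1) t :=
      funext fun t => (hasDerivAt_besselSeries hν t).deriv
    rw [this]
    exact (ih (by linarith)).neg

/-- The differential equation `t H'' + (ν + 1) H' + H = 0`, by the recurrence relation. -/
theorem besselSeries_recurrence {ν : ℝ} (hν : 0 ≤ ν) (t : ℝ) :
    t * besselSeries (ν + 2) t - (ν + 1) * besselSeries (ν + 1) t + besselSeries ν t = 0 := by
  have s0 := summable_besselSeries hν t
  have s1 := summable_besselSeries (by linarith : 0 ≤ ν + 1) t
  have s2 := summable_besselSeries (by linarith : 0 ≤ ν + 2) t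
  unfold besselSeries
  have g0 : Real.Gamma (ν + 1) ≠ 0 := (Real.Gamma_pos_of_pos (by linarith)).ne'
  have g1 : Real.Gamma (ν + 1 + 1) = (ν + 1) * Real.Gamma (ν + 1) :=
    Real.Gamma_add_one (by linarith)
  have hν1 : ν + 1 ≠ 0 := by linarith
  rw [s0.tsum_eq_zero_add, s1.tsum_eq_zero_add, ← tsum_mul_left, mul_add, ← tsum_mul_left]
  -- The constant terms cancel by `Γ(ν + 2) = (ν + 1) Γ(ν + 1)`; what remains is compared at `t ^ (m
  -- + 1)`.
  have e0 : (ν + 1) * (besselCoeff (ν + 1) 0 * t ^ 0) = besselCoeff ν 0 * t ^ 0 := by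
    simp [besselCoeff, g1]
    field_simp
  rw [e0]
  have s0' := (summable_nat_add_iff 1).2 s0
  have s1' := ((summable_nat_add_iff 1).2 s1).mul_left (ν + 1)
  have s2' := s2.mul_left t
  have : ∑' m : ℕ, t * (besselCoeff (ν + 2) m * t ^ m) -
      ∑' m : ℕ, (ν + 1) * (besselCoeff (ν + 1) (m + 1) * t ^ (m + 1)) +
      ∑' m : ℕ, besselCoeff ν (m + 1) * t ^ (m + 1) = 0 := by
    rw [← s2'.tsum_sub s1', ← (s2'.sub s1').tsum_add s0']
    rw [← tsum_zero (α := ℝ) (β := ℕ)]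
    refine tsum_congr fun m => ?_
    have h2 : (m.factorial : ℝ) ≠ 0 := by exact_mod_cast m.factorial_pos.ne'
    have h3 : ((m : ℝ) + 1) ≠ 0 := by positivity
    have h4 : (m : ℝ) + ν + 2 ≠ 0 := by positivity
    have h5 : Real.Gamma (m + ν + 2) ≠ 0 := (Real.Gamma_pos_of_pos (by positivity)).ne'
    have a2 : (m : ℝ) + (ν + 2) + 1 = (m + ν + 2) + 1 := by ring
    have a1 : ((m + 1 : ℕ) : ℝ) + (ν + 1) + 1 = (m + ν + 2) + 1 := by push_cast; ring
    have a0 : ((m + 1 : ℕ) : ℝ) + ν + 1 = m + ν + 2 := by push_cast; ring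
    rw [besselCoeff, besselCoeff, besselCoeff, a2, a1, a0, Real.Gamma_add_one h4,
      Nat.factorial_succ]
    push_cast
    field_simp
    ring
  linarith

theorem besselJ_eq {ν x : ℝ} (hx : 0 < x) :
    besselJ ν x = (x / 2) ^ ν * besselSeries ν ((x / 2) ^ 2) := by
  rw [besselJ, besselSeries, ← tsum_mul_left]
  refine tsum_congr fun m => ?_
  rw [Real.rpow_add (by positivity), besselCoeff, ← pow_mul]
  have : (x / 2) ^ (2 * (m : ℝ)) = (x / 2) ^ (2 * m) := by
    rw [← Real.rpow_natCast]; push_cast; rfl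
  rw [this]
  ring

theorem besselJ_eq_zero_iff {ν x : ℝ} (hx : 0 < x) :
    besselJ ν x = 0 ↔ besselSeries ν ((x / 2) ^ 2) = 0 := by
  rw [besselJ_eq hx, mul_eq_zero, or_iff_right (by positivity)]

theorem besselSeries_zero_pos {ν : ℝ} (hν : 0 ≤ ν) : 0 < besselSeries ν 0 := by
  have : besselSeries ν 0 = besselCoeff ν 0 := by
    rw [besselSeries, tsum_eq_single 0 (fun m hm => by simp [hm])]
    simp
  rw [this, besselCoeff]
  have : 0 < Real.Gamma (ν + 1) := Real.Gamma_pos_of_pos (by linarith)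
  simp [this]

/-- If `H_ν` has no zero in `(0, T)`, then it is positive in `[0, T)`. -/
theorem besselSeries_pos_of_ne_zero {ν T : ℝ} (hν : 0 ≤ ν)
    (h : ∀ t, 0 < t → t < T → besselSeries ν t ≠ 0) {t : ℝ} (ht : 0 ≤ t) (htT : t < T) :
    0 < besselSeries ν t := by
  by_contra! hneg
  have hc := (contDiff_besselSeries hν).continuous
  obtain ⟨s, hs, hs0⟩ := intermediate_value_Icc' ht hc.continuousOn
    (mem_Icc.2 ⟨hneg, (besselSeries_zero_pos hν).le⟩)
  rcases hs.1.eq_or_lt with rfl | hpos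
  · exact (besselSeries_zero_pos hν).ne' hs0
  · exact h s hpos (hs.2.trans_lt htT) hs0

/-- The infimum lies in the closure of the zero set, where `H_ν((x/2)²) = 0` persists; it is not `0`
because `H_ν(0) > 0`. -/
theorem isLeast_firstBesselZero {ν : ℝ} (hν : 0 ≤ ν) (h : (besselZeros ν).Nonempty) :
    IsLeast (besselZeros ν) (firstBesselZero ν) := by
  have hbdd : BddBelow (besselZeros ν) := ⟨0, fun x hx => hx.1.le⟩
  have hc := (contDiff_besselSeries hν).continuous
  refine ⟨?_, fun x hx => csInf_le hbdd hx⟩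
  have hcl : firstBesselZero ν ∈ closure (besselZeros ν) := csInf_mem_closure h hbdd
  have hsub : closure (besselZeros ν) ⊆ {x | 0 ≤ x ∧ besselSeries ν ((x / 2) ^ 2) = 0} := by
    refine closure_minimal (fun x hx => ⟨hx.1.le, (besselJ_eq_zero_iff hx.1).1 hx.2⟩) ?_
    exact IsClosed.inter (isClosed_Ici (a := (0 : ℝ))) (isClosed_eq (hc.comp (by fun_prop)) continuous_const)
  obtain ⟨h0, h1⟩ := hsub hcl
  rcases h0.eq_or_lt with h0 | h0
  · rw [← h0] at h1
    simp only [zero_div, ne_eq, OfNat.ofNat_ne_zero, not_false_eq_true, zero_pow] at h1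
    exact absurd h1 (besselSeries_zero_pos hν).ne'
  · exact ⟨h0, (besselJ_eq_zero_iff h0).2 h1⟩

theorem two_mul_sqrt_mem_besselZeros {ν s : ℝ} (hs : 0 < s) (h0 : besselSeries ν s = 0) :
    2 * √s ∈ besselZeros ν := by
  have hpos : 0 < 2 * √s := by positivity
  refine ⟨hpos, (besselJ_eq_zero_iff hpos).2 ?_⟩
  rw [mul_div_cancel_left₀ _ two_ne_zero, Real.sq_sqrt hs.le, h0]

/-- `H_ν` is positive in `[0, j ^ 2 / 4)` and vanishes at `j ^ 2 / 4`. -/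
theorem besselSeries_firstBesselZero {ν j : ℝ} (hν : 0 ≤ ν) (hj : IsLeast (besselZeros ν) j) :
    besselSeries ν (j ^ 2 / 4) = 0 ∧ ∀ t, 0 ≤ t → t < j ^ 2 / 4 → 0 < besselSeries ν t := by
  have hj0 := hj.1.1
  have e : (j / 2) ^ 2 = j ^ 2 / 4 := by ring
  refine ⟨e ▸ (besselJ_eq_zero_iff hj0).1 hj.1.2, fun t ht htj => ?_⟩
  refine besselSeries_pos_of_ne_zero hν (fun s hs hsj h0 => ?_) ht htj
  have h1 := hj.2 (two_mul_sqrt_mem_besselZeros hs h0)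
  have h2 : j ^ 2 ≤ (2 * √s) ^ 2 := by gcongr
  rw [mul_pow, Real.sq_sqrt hs.le] at h2
  linarith

/-! ### Convergence in `L²` -/

section LTwo

variable {α V W : Type*} [MeasurableSpace α] {μ : Measure α} [NormedAddCommGroup V]
  [NormedAddCommGroup W]

theorem integrable_comp_of_quadratic {N : V → W} (hN : Continuous N)
    (hq : ∀ y, ‖N y‖ ≤ ‖y‖ ^ 2) {a : α → V} (ha : MemLp a 2 μ) :
    Integrable (fun x => N (a x)) μ := by
  refine Integrable.mono' ((memLp_two_iff_integrable_sq_norm ha.1).1 ha)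
    (hN.comp_aestronglyMeasurable ha.1) (ae_of_all _ fun x => hq _)

/-- Quadratic functionals are continuous on `L²`. -/
theorem tendsto_integral_of_quadratic [NormedSpace ℝ W] {N : V → W}
    (hN : Continuous N) (hN0 : N 0 = 0)
    (hq : ∀ y z, ‖N y - N z‖ ≤ ‖y - z‖ * (‖y - z‖ + 2 * ‖z‖))
    {a : ℕ → α → V} {b : α → V} (ha : ∀ k, MemLp (a k) 2 μ) (hb : MemLp b 2 μ)
    (h : Tendsto (fun k => eLpNorm (fun x => a k x - b x) 2 μ) atTop (𝓝 0)) :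
    Tendsto (fun k => ∫ x, N (a k x) ∂μ) atTop (𝓝 (∫ x, N (b x) ∂μ)) := by
  have hq' : ∀ y, ‖N y‖ ≤ ‖y‖ ^ 2 := fun y => by
    have := hq y 0
    simp only [hN0, sub_zero, norm_zero, mul_zero, add_zero] at this
    linarith [sq ‖y‖]
  refine tendsto_integral_of_L1' _ (integrable_comp_of_quadratic hN hq' hb).1
    (Eventually.of_forall fun k => integrable_comp_of_quadratic hN hq' (ha k)) ?_
  -- By the Cauchy–Schwarz inequality the `L¹` distance of `N ∘ a k` and `N ∘ b` is at most this
  -- product.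
  have hlim : Tendsto (fun k => eLpNorm (fun x => a k x - b x) 2 μ *
      (eLpNorm (fun x => a k x - b x) 2 μ + 2 * eLpNorm b 2 μ)) atTop (𝓝 0) := by
    have h2 : Tendsto (fun k => eLpNorm (fun x => a k x - b x) 2 μ + 2 * eLpNorm b 2 μ) atTop
        (𝓝 (0 + 2 * eLpNorm b 2 μ)) := h.add tendsto_const_nhds
    have hne : 0 + 2 * eLpNorm b 2 μ ≠ ⊤ := by
      rw [zero_add]; exact ENNReal.mul_ne_top (by simp) hb.2.ne
    have := ENNReal.Tendsto.mul h (Or.inr hne) h2 (Or.inr ENNReal.zero_ne_top)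
    rwa [zero_mul] at this
  refine tendsto_of_tendsto_of_tendsto_of_le_of_le tendsto_const_nhds hlim (fun _ => zero_le)
    fun k => ?_
  have hd : AEStronglyMeasurable (fun x => a k x - b x) μ := (ha k).1.sub hb.1
  calc eLpNorm ((fun x => N (a k x)) - fun x => N (b x)) 1 μ
      ≤ eLpNorm ((fun x => ‖a k x - b x‖) • fun x => ‖a k x - b x‖ + 2 * ‖b x‖) 1 μ := by
        refine eLpNorm_mono_real fun x => ?_
        exact hq _ _
    _ ≤ eLpNorm (fun x => ‖a k x - b x‖) 2 μ *
          eLpNorm (fun x => ‖a k x - b x‖ + 2 * ‖b x‖) 2 μ :=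
        eLpNorm_smul_le_mul_eLpNorm (hd.norm.add (hb.1.norm.const_mul 2)) hd.norm
    _ ≤ _ := by
        rw [eLpNorm_norm]
        gcongr
        refine (eLpNorm_add_le hd.norm (hb.1.norm.const_mul 2) (by norm_num)).trans ?_
        rw [eLpNorm_norm]
        gcongr
        have := eLpNorm_const_smul_le (c := (2 : ℝ)) (f := fun x => ‖b x‖) (p := 2) (μ := μ)
        rw [eLpNorm_norm] at this
        refine (le_of_eq ?_).trans (this.trans (le_of_eq ?_))
        · rfl
        · congr 1
          rw [Real.enorm_eq_ofReal (by norm_num)]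
          simp

/-- The pairing of `L²` is continuous in the first variable. -/
theorem tendsto_integral_smul_of_tendsto [NormedSpace ℝ W] {f : ℕ → α → ℝ} {f' : α → ℝ}
    {g : α → W} (hf : ∀ k, MemLp (f k) 2 μ) (hf' : MemLp f' 2 μ) (hg : MemLp g 2 μ)
    (h : Tendsto (fun k => eLpNorm (fun x => f k x - f' x) 2 μ) atTop (𝓝 0)) :
    Tendsto (fun k => ∫ x, f k x • g x ∂μ) atTop (𝓝 (∫ x, f' x • g x ∂μ)) := by
  refine tendsto_integral_of_L1' _ (hf'.1.smul hg.1)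
    (Eventually.of_forall fun k => memLp_one_iff_integrable.1 (hg.smul (hf k))) ?_
  have hlim : Tendsto (fun k => eLpNorm (fun x => f k x - f' x) 2 μ * eLpNorm g 2 μ) atTop
      (𝓝 0) := by
    have := ENNReal.Tendsto.mul_const h (Or.inr hg.2.ne)
    rwa [zero_mul] at this
  refine tendsto_of_tendsto_of_tendsto_of_le_of_le tendsto_const_nhds hlim (fun _ => zero_le)
    fun k => ?_
  refine le_trans (le_of_eq ?_)
    (eLpNorm_smul_le_mul_eLpNorm (p := 2) (q := 2) (r := 1) hg.1 ((hf k).1.sub hf'.1))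
  congr 1
  funext x
  simp [sub_smul]

theorem tendsto_integral_smul_of_tendsto' [NormedSpace ℝ W] {f : ℕ → α → W} {f' : α → W}
    {g : α → ℝ} (hf : ∀ k, MemLp (f k) 2 μ) (hf' : MemLp f' 2 μ) (hg : MemLp g 2 μ)
    (h : Tendsto (fun k => eLpNorm (fun x => f k x - f' x) 2 μ) atTop (𝓝 0)) :
    Tendsto (fun k => ∫ x, g x • f k x ∂μ) atTop (𝓝 (∫ x, g x • f' x ∂μ)) := by
  refine tendsto_integral_of_L1' _ (hg.1.smul hf'.1)
    (Eventually.of_forall fun k => memLp_one_iff_integrable.1 ((hf k).smul hg)) ?_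
  have hlim : Tendsto (fun k => eLpNorm g 2 μ * eLpNorm (fun x => f k x - f' x) 2 μ) atTop
      (𝓝 0) := by
    have := ENNReal.Tendsto.const_mul h (Or.inr hg.2.ne)
    rwa [mul_zero] at this
  refine tendsto_of_tendsto_of_tendsto_of_le_of_le tendsto_const_nhds hlim (fun _ => zero_le)
    fun k => ?_
  refine le_trans (le_of_eq ?_)
    (eLpNorm_smul_le_mul_eLpNorm (p := 2) (q := 2) (r := 1) ((hf k).1.sub hf'.1) hg.1)
  congr 1
  funext x
  simp [smul_sub]

theorem tendsto_integral_inner_of_tendsto [InnerProductSpace ℝ V] {f : ℕ → α → V} {f' g : α → V}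
    (hf : ∀ k, MemLp (f k) 2 μ) (hf' : MemLp f' 2 μ) (hg : MemLp g 2 μ)
    (h : Tendsto (fun k => eLpNorm (fun x => f k x - f' x) 2 μ) atTop (𝓝 0)) :
    Tendsto (fun k => ∫ x, inner ℝ (f k x) (g x) ∂μ) atTop (𝓝 (∫ x, inner ℝ (f' x) (g x) ∂μ)) := by
  have e : ∀ {f : α → V} (hf : MemLp f 2 μ),
      inner ℝ (hf.toLp f) (hg.toLp g) = ∫ x, inner ℝ (f x) (g x) ∂μ := by
    intro f hf
    rw [L2.inner_def]
    refine integral_congr_ae ?_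
    filter_upwards [hf.coeFn_toLp, hg.coeFn_toLp] with x h1 h2
    rw [h1, h2]
  have h1 := Tendsto.inner (𝕜 := ℝ) ((Lp.tendsto_Lp_iff_tendsto_eLpNorm'' f hf f' hf').2 h)
    (tendsto_const_nhds (x := hg.toLp g))
  simpa only [e] using h1

/-- Dominated convergence in `L²`. -/
theorem tendsto_eLpNorm_two_of_dominated {F : ℕ → α → V} {f : α → V} {b : α → ℝ}
    (hF : ∀ k, AEStronglyMeasurable (F k) μ) (hf : AEStronglyMeasurable f μ) (hb : MemLp b 2 μ)
    (hbd : ∀ k, ∀ᵐ x ∂μ, ‖F k x - f x‖ ≤ b x)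
    (hlim : ∀ᵐ x ∂μ, Tendsto (fun k => F k x) atTop (𝓝 (f x))) :
    Tendsto (fun k => eLpNorm (fun x => F k x - f x) 2 μ) atTop (𝓝 0) := by
  have key : Tendsto (fun k => ∫⁻ x, ‖F k x - f x‖ₑ ^ (2 : ℝ) ∂μ) atTop (𝓝 (∫⁻ _, 0 ∂μ)) := by
    refine tendsto_lintegral_of_dominated_convergence' (fun x => ‖b x‖ₑ ^ (2 : ℝ))
      (fun k => ((hF k).sub hf).enorm.pow_const _) (fun k => ?_) ?_ ?_
    · filter_upwards [hbd k] with x hx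
      gcongr
      refine enorm_le_iff_norm_le.2 (hx.trans (le_abs_self _))
    · have := lintegral_rpow_enorm_lt_top_of_eLpNorm_lt_top (p := 2) (by simp) (by simp) hb.2
      exact (by simpa using this : _ < _).ne
    · filter_upwards [hlim] with x hx
      have h1 : Tendsto (fun k => ‖F k x - f x‖ₑ) atTop (𝓝 0) := by
        rw [← enorm_zero (E := V), ← sub_self (f x)]
        exact (hx.sub_const _).enorm
      have h2 := (ENNReal.continuous_rpow_const (y := 2)).continuousAt.tendsto.comp h1
      rwa [ENNReal.zero_rpow_of_pos (by norm_num)] at h2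
  rw [lintegral_zero] at key
  have := (ENNReal.continuous_rpow_const (y := (1 / 2 : ℝ))).continuousAt.tendsto.comp key
  simp only [one_div, Function.comp_def] at this
  rw [ENNReal.zero_rpow_of_pos (by norm_num)] at this
  refine this.congr fun k => ?_
  rw [eLpNorm_eq_lintegral_rpow_enorm_toReal (by simp) (by simp)]
  simp

end LTwo

theorem norm_sq_sub_norm_sq_le {V : Type*} [NormedAddCommGroup V] (y z : V) :
    ‖‖y‖ ^ 2 - ‖z‖ ^ 2‖ ≤ ‖y - z‖ * (‖y - z‖ + 2 * ‖z‖) := by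
  have h1 : |‖y‖ - ‖z‖| ≤ ‖y - z‖ := abs_norm_sub_norm_le y z
  have h2 : ‖y‖ ≤ ‖y - z‖ + ‖z‖ := by simpa using norm_add_le (y - z) z
  rw [Real.norm_eq_abs, sq_sub_sq, abs_mul, mul_comm, abs_of_nonneg (a := ‖y‖ + ‖z‖) (by positivity)]
  exact mul_le_mul h1 (by linarith) (by positivity) (by positivity)

/-- This makes `∫ |u| u` continuous on `L²`, through `tendsto_integral_of_quadratic`. -/
theorem abs_mul_self_sub_abs_mul_self_le (y z : ℝ) :
    ‖|y| * y - |z| * z‖ ≤ ‖y - z‖ * (‖y - z‖ + 2 * ‖z‖) := by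
  have h1 : |(|y| - |z|)| ≤ |y - z| := abs_abs_sub_abs_le_abs_sub y z
  have h2 : |y| ≤ |y - z| + |z| := by simpa using abs_add_le (y - z) z
  have e : |y| * y - |z| * z = |y| * (y - z) + (|y| - |z|) * z := by ring
  simp only [Real.norm_eq_abs]
  rw [e]
  refine (abs_add_le _ _).trans ?_
  rw [abs_mul, abs_mul, abs_abs]
  nlinarith [abs_nonneg z, abs_nonneg (y - z)]

/-! ### Integration by parts -/

/-- Integration by parts against the constant function `1`. -/
theorem integral_fderiv_eq_zero {g : E n → ℝ} (hg : ContDiff ℝ 1 g) (hc : HasCompactSupport g)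
    (v : E n) : ∫ x, fderiv ℝ g x v = 0 := by
  have hcont : Continuous fun x => fderiv ℝ g x v :=
    (hg.continuous_fderiv one_ne_zero).clm_apply continuous_const
  have hsupp : HasCompactSupport fun x => fderiv ℝ g x v := hc.fderiv_apply ℝ v
  have h := integral_mul_fderiv_eq_neg_fderiv_mul_of_integrable (μ := (volume : Measure (E n)))
    (f := fun _ => (1 : ℝ)) (g := g) (v := v) (by simp)
    (by simpa using hcont.integrable_of_hasCompactSupport hsupp)
    (by simpa using hg.continuous.integrable_of_hasCompactSupport hc)
    (fun _ _ => by fun_prop) (fun x _ => hg.differentiable one_ne_zero x)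
  simpa using h

namespace IsTestFunction

variable {Ω : Set (E n)} {φ ψ : E n → ℝ}

theorem differentiable (hφ : IsTestFunction Ω φ) : Differentiable ℝ φ :=
  hφ.contDiff.differentiable (by simp)

theorem contDiff_one (hφ : IsTestFunction Ω φ) : ContDiff ℝ 1 φ :=
  hφ.contDiff.of_le (by exact_mod_cast le_top)

theorem continuous_gradient (hφ : IsTestFunction Ω φ) : Continuous (∇ φ) :=
  (InnerProductSpace.toDual ℝ (E n)).symm.continuous.comp
    (hφ.contDiff_one.continuous_fderiv one_ne_zero)

theorem apply_eq_zero (hφ : IsTestFunction Ω φ) {x : E n} (hx : x ∉ Ω) : φ x = 0 :=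
  image_eq_zero_of_notMem_tsupport fun h => hx (hφ.tsupport_subset h)

theorem gradient_eq_zero_of_notMem_tsupport {φ : E n → ℝ} {x : E n} (hx : x ∉ tsupport φ) :
    ∇ φ x = 0 := by
  have : fderiv ℝ φ x = 0 := by
    by_contra h
    exact hx (support_fderiv_subset ℝ h)
  simp [gradient, this]

theorem gradient_eq_zero (hφ : IsTestFunction Ω φ) {x : E n} (hx : x ∉ Ω) : ∇ φ x = 0 :=
  gradient_eq_zero_of_notMem_tsupport fun h => hx (hφ.tsupport_subset h)

theorem hasCompactSupport_gradient (hφ : IsTestFunction Ω φ) : HasCompactSupport (∇ φ) :=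
  HasCompactSupport.intro hφ.hasCompactSupport fun _ hx => gradient_eq_zero_of_notMem_tsupport hx

theorem memLp (hφ : IsTestFunction Ω φ) : MemLp φ 2 (volume.restrict Ω) :=
  (hφ.contDiff.continuous.memLp_of_hasCompactSupport hφ.hasCompactSupport).restrict Ω

theorem memLp_gradient (hφ : IsTestFunction Ω φ) : MemLp (∇ φ) 2 (volume.restrict Ω) :=
  (hφ.continuous_gradient.memLp_of_hasCompactSupport hφ.hasCompactSupport_gradient).restrict Ω

theorem const_mul (hφ : IsTestFunction Ω φ) (c : ℝ) : IsTestFunction Ω fun x => c * φ x :=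
  ⟨contDiff_const.mul hφ.contDiff, hφ.hasCompactSupport.mul_left,
    (tsupport_mul_subset_right (f := fun _ => c)).trans hφ.tsupport_subset⟩

theorem add (hφ : IsTestFunction Ω φ) (hψ : IsTestFunction Ω ψ) :
    IsTestFunction Ω fun x => φ x + ψ x :=
  ⟨hφ.contDiff.add hψ.contDiff, hφ.hasCompactSupport.add hψ.hasCompactSupport,
    (tsupport_add φ ψ).trans (union_subset hφ.tsupport_subset hψ.tsupport_subset)⟩

theorem gradient_const_mul (hφ : IsTestFunction Ω φ) (c : ℝ) (x : E n) :
    ∇ (fun x => c * φ x) x = c • ∇ φ x := by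
  simp [gradient, fderiv_const_mul (hφ.differentiable x)]

theorem gradient_add (hφ : IsTestFunction Ω φ) (hψ : IsTestFunction Ω ψ) (x : E n) :
    ∇ (fun x => φ x + ψ x) x = ∇ φ x + ∇ ψ x := by
  simp [gradient, fderiv_fun_add (hφ.differentiable x) (hψ.differentiable x)]

theorem mono {Ω' : Set (E n)} (hφ : IsTestFunction Ω φ) (h : Ω ⊆ Ω') : IsTestFunction Ω' φ :=
  ⟨hφ.contDiff, hφ.hasCompactSupport, hφ.tsupport_subset.trans h⟩

theorem integral_smul_gradient (hφ : IsTestFunction Ω φ) (hψ : IsTestFunction Ω ψ) :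
    ∫ x in Ω, φ x • ∇ ψ x = -∫ x in Ω, ψ x • ∇ φ x := by
  rw [setIntegral_eq_integral_of_forall_compl_eq_zero
      (fun x hx => by simp [hφ.apply_eq_zero hx]),
    setIntegral_eq_integral_of_forall_compl_eq_zero (fun x hx => by simp [hψ.apply_eq_zero hx])]
  have i1 : Integrable fun x => φ x • ∇ ψ x :=
    (hφ.contDiff.continuous.smul hψ.continuous_gradient).integrable_of_hasCompactSupport
      hφ.hasCompactSupport.smul_right
  have i2 : Integrable fun x => ψ x • ∇ φ x :=
    (hψ.contDiff.continuous.smul hφ.continuous_gradient).integrable_of_hasCompactSupport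
      hψ.hasCompactSupport.smul_right
  rw [← add_eq_zero_iff_eq_neg, ← integral_add i1 i2]
  -- Paired with a fixed `v`, the sum of the two integrands is the derivative of `φ ψ` in the
  -- direction `v`.
  refine ext_inner_right ℝ fun v => ?_
  rw [inner_zero_left, real_inner_comm]
  refine (integral_inner (i1.add i2) v).symm.trans ?_
  refine Eq.trans ?_ (integral_fderiv_eq_zero (g := fun x => φ x * ψ x)
    (hφ.contDiff_one.mul hψ.contDiff_one) hφ.hasCompactSupport.mul_right v)
  refine integral_congr_ae (ae_of_all _ fun x => ?_)
  simp only [Pi.add_apply]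
  rw [fderiv_fun_mul (hφ.differentiable x) (hψ.differentiable x), real_inner_comm,
    inner_add_left, inner_smul_left, inner_smul_left, inner_gradient_left, inner_gradient_left]
  simp

end IsTestFunction

/-! ### Limits of test functions -/

/-- `(u, g)` is the limit in `L²(Ω)` of `(φ_k, ∇ φ_k)` for a sequence of test functions. -/
structure HasTestApprox (Ω : Set (E n)) (u : E n → ℝ) (g : E n → E n) : Prop where
  memLp : MemLp u 2 (volume.restrict Ω)
  memLp_grad : MemLp g 2 (volume.restrict Ω)
  exists_approx : ∃ φ : ℕ → E n → ℝ, (∀ k, IsTestFunction Ω (φ k)) ∧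
    Tendsto (fun k => eLpNorm (fun x => φ k x - u x) 2 (volume.restrict Ω)) atTop (𝓝 0) ∧
    Tendsto (fun k => eLpNorm (fun x => ∇ (φ k) x - g x) 2 (volume.restrict Ω)) atTop (𝓝 0)

theorem MemW12Zero.hasTestApprox {Ω : Set (E n)} {u : E n → ℝ} (h : MemW12Zero Ω u) :
    HasTestApprox Ω u (weakGradient Ω u) :=
  ⟨h.memLp, h.memLp_grad, h.exists_approx⟩

theorem IsTestFunction.hasTestApprox {Ω : Set (E n)} {φ : E n → ℝ} (h : IsTestFunction Ω φ) :
    HasTestApprox Ω φ (∇ φ) :=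
  ⟨h.memLp, h.memLp_gradient, fun _ => φ, fun _ => h, by simp, by simp⟩

namespace HasTestApprox

variable {Ω : Set (E n)} {u u' : E n → ℝ} {g g' : E n → E n}

/-- Integration by parts between test functions passes to the `L²` limit. By uniqueness of weak
gradients any such `g` may then replace the chosen `weakGradient`. -/
theorem isWeakGradient (hΩ : IsOpen Ω) (h : HasTestApprox Ω u g) : IsWeakGradient Ω u g := by
  have hloc : ∀ {V : Type} [NormedAddCommGroup V] {f : E n → V},
      MemLp f 2 (volume.restrict Ω) → LocallyIntegrableOn f Ω := by
    intro V _ f hf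
    refine (locallyIntegrableOn_iff hΩ.isLocallyClosed).2 fun K hK hKc => ?_
    have : IsFiniteMeasure (volume.restrict K) := ⟨by simpa using hKc.measure_lt_top⟩
    exact (hf.mono_measure (Measure.restrict_mono hK le_rfl)).integrable (by norm_num)
  refine ⟨hloc h.memLp, hloc h.memLp_grad, fun ψ hψ => ?_⟩
  obtain ⟨φ, hφ, h1, h2⟩ := h.exists_approx
  have t1 := tendsto_integral_smul_of_tendsto (fun k => (hφ k).memLp) h.memLp hψ.memLp_gradient h1
  have t2 := tendsto_integral_smul_of_tendsto' (fun k => (hφ k).memLp_gradient) h.memLp_grad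
    hψ.memLp h2
  refine tendsto_nhds_unique t1 ?_
  simpa only [(hφ _).integral_smul_gradient hψ] using t2.neg

theorem weakGradient_ae_eq (hΩ : IsOpen Ω) (h : HasTestApprox Ω u g) :
    weakGradient Ω u =ᵐ[volume.restrict Ω] g :=
  (isWeakGradient_weakGradient ⟨g, h.isWeakGradient hΩ⟩).ae_eq hΩ (h.isWeakGradient hΩ)

theorem memW12Zero (hΩ : IsOpen Ω) (h : HasTestApprox Ω u g) : MemW12Zero Ω u := by
  have hae := h.weakGradient_ae_eq hΩ
  obtain ⟨φ, hφ, h1, h2⟩ := h.exists_approx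
  refine ⟨⟨h.memLp, ⟨g, h.isWeakGradient hΩ⟩, h.memLp_grad.ae_eq hae.symm⟩, φ, hφ, h1, ?_⟩
  refine h2.congr fun k => eLpNorm_congr_ae ?_
  filter_upwards [hae] with x hx
  rw [hx]

theorem integral_norm_weakGradient (hΩ : IsOpen Ω) (h : HasTestApprox Ω u g) :
    ∫ x in Ω, ‖weakGradient Ω u x‖ ^ 2 = ∫ x in Ω, ‖g x‖ ^ 2 := by
  refine integral_congr_ae ?_
  filter_upwards [h.weakGradient_ae_eq hΩ] with x hx
  rw [hx]

theorem const_mul (h : HasTestApprox Ω u g) (c : ℝ) :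
    HasTestApprox Ω (fun x => c * u x) (fun x => c • g x) := by
  obtain ⟨φ, hφ, h1, h2⟩ := h.exists_approx
  refine ⟨h.memLp.const_mul c, h.memLp_grad.const_smul c, fun k x => c * φ k x,
    fun k => (hφ k).const_mul c, ?_, ?_⟩
  · have := ENNReal.Tendsto.const_mul (a := ‖c‖ₑ) h1 (Or.inr enorm_ne_top)
    rw [mul_zero] at this
    refine this.congr fun k => ?_
    rw [← eLpNorm_const_smul]
    congr 1; funext x; simp [mul_sub]
  · have := ENNReal.Tendsto.const_mul (a := ‖c‖ₑ) h2 (Or.inr enorm_ne_top)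
    rw [mul_zero] at this
    refine this.congr fun k => ?_
    rw [← eLpNorm_const_smul]
    congr 1; funext x; simp [(hφ k).gradient_const_mul, smul_sub]

theorem add (h : HasTestApprox Ω u g) (h' : HasTestApprox Ω u' g') :
    HasTestApprox Ω (fun x => u x + u' x) (fun x => g x + g' x) := by
  obtain ⟨φ, hφ, h1, h2⟩ := h.exists_approx
  obtain ⟨φ', hφ', h1', h2'⟩ := h'.exists_approx
  refine ⟨h.memLp.add h'.memLp, h.memLp_grad.add h'.memLp_grad, fun k x => φ k x + φ' k x,
    fun k => (hφ k).add (hφ' k), ?_, ?_⟩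
  · refine tendsto_of_tendsto_of_tendsto_of_le_of_le tendsto_const_nhds
      (by simpa using h1.add h1') (fun _ => zero_le) fun k => ?_
    refine le_trans (le_of_eq ?_) (eLpNorm_add_le ((hφ k).memLp.1.sub h.memLp.1)
      ((hφ' k).memLp.1.sub h'.memLp.1) (by norm_num))
    congr 1; funext x; simp only [Pi.add_apply]; ring
  · refine tendsto_of_tendsto_of_tendsto_of_le_of_le tendsto_const_nhds
      (by simpa using h2.add h2') (fun _ => zero_le) fun k => ?_
    refine le_trans (le_of_eq ?_) (eLpNorm_add_le ((hφ k).memLp_gradient.1.sub h.memLp_grad.1)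
      ((hφ' k).memLp_gradient.1.sub h'.memLp_grad.1) (by norm_num))
    congr 1; funext x
    simp only [Pi.add_apply, (hφ k).gradient_add (hφ' k)]; abel

/-- Everything vanishes outside `Ω`, so the norms over `Ω'` are those over `Ω`. This carries
eigenfunctions of a ball to a larger set. -/
theorem mono {Ω' : Set (E n)} (hΩ' : MeasurableSet Ω) (h : HasTestApprox Ω u g) (hs : Ω ⊆ Ω')
    (hu : ∀ x ∉ Ω, u x = 0) (hg : ∀ x ∉ Ω, g x = 0) : HasTestApprox Ω' u g := by
  obtain ⟨φ, hφ, h1, h2⟩ := h.exists_approx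
  have key : ∀ {V : Type} [NormedAddCommGroup V] (f : E n → V), (∀ x ∉ Ω, f x = 0) →
      f = Ω.indicator f := by
    intro V _ f hf
    refine (indicator_eq_self.2 fun x hx => ?_).symm
    by_contra h0
    exact hx (hf x h0)
  have hr : (volume.restrict Ω').restrict Ω = volume.restrict Ω := by
    rw [Measure.restrict_restrict hΩ', inter_eq_left.2 hs]
  refine ⟨?_, ?_, φ, fun k => (hφ k).mono hs, h1.congr fun k => ?_, h2.congr fun k => ?_⟩
  · rw [key u hu, memLp_indicator_iff_restrict hΩ', hr]; exact h.memLp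
  · rw [key g hg, memLp_indicator_iff_restrict hΩ', hr]; exact h.memLp_grad
  · rw [← hr, ← eLpNorm_indicator_eq_eLpNorm_restrict hΩ', ← key _ fun x hx => by
        simp [(hφ k).apply_eq_zero hx, hu x hx]]
  · rw [← hr, ← eLpNorm_indicator_eq_eLpNorm_restrict hΩ', ← key _ fun x hx => by
        simp [(hφ k).gradient_eq_zero hx, hg x hx]]

/-- The three integrals of the variational problems are limits of those of test functions. -/
theorem exists_tendsto_integral (h : HasTestApprox Ω u g) :
    ∃ φ : ℕ → E n → ℝ, (∀ k, IsTestFunction Ω (φ k)) ∧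
      Tendsto (fun k => ∫ x in Ω, |φ k x| ^ 2) atTop (𝓝 (∫ x in Ω, |u x| ^ 2)) ∧
      Tendsto (fun k => ∫ x in Ω, |φ k x| * φ k x) atTop (𝓝 (∫ x in Ω, |u x| * u x)) ∧
      Tendsto (fun k => ∫ x in Ω, ‖∇ (φ k) x‖ ^ 2) atTop (𝓝 (∫ x in Ω, ‖g x‖ ^ 2)) := by
  obtain ⟨φ, hφ, h1, h2⟩ := h.exists_approx
  refine ⟨φ, hφ, ?_, ?_, ?_⟩
  · exact tendsto_integral_of_quadratic (N := fun y : ℝ => |y| ^ 2) (by fun_prop) (by simp)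
      (fun y z => norm_sq_sub_norm_sq_le y z) (fun k => (hφ k).memLp) h.memLp h1
  · exact tendsto_integral_of_quadratic (N := fun y : ℝ => |y| * y) (by fun_prop) (by simp)
      abs_mul_self_sub_abs_mul_self_le (fun k => (hφ k).memLp) h.memLp h1
  · exact tendsto_integral_of_quadratic (N := fun y : E n => ‖y‖ ^ 2) (by fun_prop) (by simp)
      norm_sq_sub_norm_sq_le (fun k => (hφ k).memLp_gradient) h.memLp_grad h2

end HasTestApprox

/-! ### Positive parts -/

/-- A smooth function that vanishes on `(-∞, 1]` and is the identity on `[2, ∞)`. -/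
def smoothPosPart (s : ℝ) : ℝ := s * Real.smoothTransition (s - 1)

theorem contDiff_smoothPosPart : ContDiff ℝ ∞ smoothPosPart :=
  contDiff_id.mul (Real.smoothTransition.contDiff.comp (contDiff_id.sub contDiff_const))

theorem smoothPosPart_of_le {s : ℝ} (hs : s ≤ 1) : smoothPosPart s = 0 := by
  simp [smoothPosPart, Real.smoothTransition.zero_of_nonpos (sub_nonpos.2 hs)]

theorem smoothPosPart_of_ge {s : ℝ} (hs : 2 ≤ s) : smoothPosPart s = s := by
  simp [smoothPosPart, Real.smoothTransition.one_of_one_le (by linarith : 1 ≤ s - 1)]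

theorem abs_smoothPosPart_le (s : ℝ) : |smoothPosPart s| ≤ |s| := by
  rw [smoothPosPart, abs_mul, abs_of_nonneg (Real.smoothTransition.nonneg _)]
  exact mul_le_of_le_one_right (abs_nonneg _) (Real.smoothTransition.le_one _)

theorem deriv_smoothPosPart_of_lt {s : ℝ} (hs : s < 1) : deriv smoothPosPart s = 0 := by
  have : smoothPosPart =ᶠ[𝓝 s] fun _ => 0 := by
    filter_upwards [Iio_mem_nhds hs] with y hy using smoothPosPart_of_le (le_of_lt hy)
  rw [this.deriv_eq, deriv_const]

theorem deriv_smoothPosPart_of_gt {s : ℝ} (hs : 2 < s) : deriv smoothPosPart s = 1 := by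
  have : smoothPosPart =ᶠ[𝓝 s] fun y => y := by
    filter_upwards [Ioi_mem_nhds hs] with y hy using smoothPosPart_of_ge (le_of_lt hy)
  rw [this.deriv_eq, deriv_id'']

theorem exists_abs_deriv_smoothPosPart_le : ∃ C, 1 ≤ C ∧ ∀ s, |deriv smoothPosPart s| ≤ C := by
  obtain ⟨C, hC⟩ := (isCompact_Icc (a := (1 : ℝ)) (b := 2)).exists_bound_of_continuousOn
    (contDiff_smoothPosPart.continuous_deriv (by simp)).continuousOn
  refine ⟨max C 1, le_max_right _ _, fun s => ?_⟩
  rcases lt_or_ge s 1 with h | h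
  · simp [deriv_smoothPosPart_of_lt h]
  rcases le_or_gt s 2 with h' | h'
  · exact (hC s ⟨h, h'⟩).trans (le_max_left _ _)
  · simp [deriv_smoothPosPart_of_gt h']

theorem hasGradientAt_comp {ρ : ℝ → ℝ} {w : E n → ℝ} {x : E n} {ρ' : ℝ}
    (hρ : HasDerivAt ρ ρ' (w x)) (hw : DifferentiableAt ℝ w x) :
    HasGradientAt (fun y => ρ (w y)) (ρ' • ∇ w x) x := by
  rw [hasGradientAt_iff_hasFDerivAt, map_smul, toDual_gradient]
  exact hρ.comp_hasFDerivAt x hw.hasFDerivAt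

/-- If `w` is smooth and `w ≤ 0` on the boundary of the bounded open set `U ⊆ Ω`, then the
positive part of `w` in `U` (extended by zero) is a limit of test functions. -/
theorem hasTestApprox_indicator_posPart {Ω U : Set (E n)} (hU : IsOpen U)
    (hb : Bornology.IsBounded U) (hUΩ : U ⊆ Ω) {w : E n → ℝ} (hw : ContDiff ℝ ∞ w)
    (hfr : ∀ x ∈ frontier U, w x ≤ 0) :
    HasTestApprox Ω (U.indicator fun x => max (w x) 0) ((U ∩ {x | 0 < w x}).indicator (∇ w)) := by
  have hcU : IsCompact (closure U) := hb.isCompact_closure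
  have hw1 : ContDiff ℝ 1 w := hw.of_le (by exact_mod_cast le_top)
  have hwd : Differentiable ℝ w := hw1.differentiable one_ne_zero
  have hgw : Continuous (∇ w) := (InnerProductSpace.toDual ℝ (E n)).symm.continuous.comp
    (hw1.continuous_fderiv one_ne_zero)
  have hW : IsOpen {x | 0 < w x} := isOpen_lt continuous_const hw.continuous
  obtain ⟨M, hM⟩ := hcU.exists_bound_of_continuousOn hw.continuous.continuousOn
  obtain ⟨M', hM'⟩ := hcU.exists_bound_of_continuousOn hgw.continuousOn
  obtain ⟨C, hC1, hC⟩ := exists_abs_deriv_smoothPosPart_le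
  have hfin : volume U < ⊤ := (measure_mono subset_closure).trans_lt hcU.measure_lt_top
  have hfin' : (volume.restrict Ω) U ≠ ⊤ :=
    ((Measure.restrict_apply_le Ω U).trans_lt hfin).ne
  have hmemc : ∀ D : ℝ, MemLp (U.indicator fun _ => D) 2 (volume.restrict Ω) :=
    fun D => memLp_indicator_const 2 hU.measurableSet D (Or.inr hfin')
  -- The rescaled cutoffs tend to `t⁺`, vanish for `t ≤ 1 / (k + 1)`, and their derivatives keep the
  -- bound `C` for all `k`.
  set ρ : ℕ → ℝ → ℝ := fun k t => ((k : ℝ) + 1)⁻¹ * smoothPosPart (((k : ℝ) + 1) * t) with hρ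
  have hρd : ∀ k t, HasDerivAt (ρ k) (deriv smoothPosPart (((k : ℝ) + 1) * t)) t := by
    intro k t
    have h1 : HasDerivAt smoothPosPart (deriv smoothPosPart (((k : ℝ) + 1) * t))
        (((k : ℝ) + 1) * t) :=
      (contDiff_smoothPosPart.differentiable (by simp) _).hasDerivAt
    have h2 : HasDerivAt (fun y => ((k : ℝ) + 1) * y) ((k : ℝ) + 1) t := by
      simpa using (hasDerivAt_id t).const_mul ((k : ℝ) + 1)
    have h3 := (h1.comp t h2).const_mul ((k : ℝ) + 1)⁻¹
    have hk : ((k : ℝ) + 1) ≠ 0 := by positivity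
    refine h3.congr_deriv ?_
    rw [mul_comm (deriv _ _), inv_mul_cancel_left₀ hk]
  have hρs : ∀ k, ContDiff ℝ ∞ (ρ k) := fun k =>
    contDiff_const.mul (contDiff_smoothPosPart.comp (contDiff_const.mul contDiff_id))
  have hρ0 : ∀ (k : ℕ) (t : ℝ), t ≤ ((k : ℝ) + 1)⁻¹ → ρ k t = 0 := by
    intro k t ht
    have hk : (0 : ℝ) < (k : ℝ) + 1 := by positivity
    have : ((k : ℝ) + 1) * t ≤ 1 := by
      calc _ ≤ ((k : ℝ) + 1) * ((k : ℝ) + 1)⁻¹ := by gcongr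
        _ = 1 := mul_inv_cancel₀ hk.ne'
    simp [hρ, smoothPosPart_of_le this]
  have hρle : ∀ (k : ℕ) (t : ℝ), |ρ k t| ≤ |t| := by
    intro k t
    have hk : (0 : ℝ) < (k : ℝ) + 1 := by positivity
    rw [hρ]
    simp only [abs_mul, abs_inv, abs_of_pos hk]
    calc _ ≤ ((k : ℝ) + 1)⁻¹ * |((k : ℝ) + 1) * t| := 
          mul_le_mul_of_nonneg_left (abs_smoothPosPart_le _) (by positivity)
      _ = |t| := by rw [abs_mul, abs_of_pos hk]; field_simp
  set φ : ℕ → E n → ℝ := fun k => U.indicator fun x => ρ k (w x) with hφ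
  -- the support of `φ k`
  have hsupp : ∀ k, tsupport (φ k) ⊆ closure U ∩ {x | ((k : ℝ) + 1)⁻¹ ≤ w x} := by
    intro k
    refine closure_minimal (fun x hx => ?_)
      (isClosed_closure.inter (isClosed_le continuous_const hw.continuous))
    have hxU : x ∈ U := by
      by_contra h; exact hx (indicator_of_notMem h _)
    refine ⟨subset_closure hxU, ?_⟩
    by_contra h
    refine hx ?_
    simp only [hφ, indicator_of_mem hxU]
    exact hρ0 k _ (le_of_not_ge h)
  -- On the support `w ≥ 1 / (k + 1) > 0`, while `w ≤ 0` on the frontier, so the support stays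
  -- inside `U`.
  have hsuppU : ∀ k, tsupport (φ k) ⊆ U := by
    intro k x hx
    obtain ⟨h1, h2⟩ := hsupp k hx
    by_contra h
    have h3 := hfr x ⟨h1, by rwa [hU.interior_eq]⟩
    have : (0 : ℝ) < ((k : ℝ) + 1)⁻¹ := by positivity
    have h4 : ((k : ℝ) + 1)⁻¹ ≤ w x := h2
    linarith
  have hev : ∀ (k : ℕ), ∀ x ∈ U, φ k =ᶠ[𝓝 x] fun y => ρ k (w y) := by
    intro k x hx
    filter_upwards [hU.mem_nhds hx] with y hy using indicator_of_mem hy _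
  have htest : ∀ k, IsTestFunction U (φ k) := by
    intro k
    refine ⟨contDiff_iff_contDiffAt.2 fun x => ?_, HasCompactSupport.of_support_subset_isCompact hcU
      ((subset_tsupport _).trans ((hsupp k).trans inter_subset_left)), hsuppU k⟩
    by_cases hx : x ∈ U
    · exact (((hρs k).comp hw).contDiffAt).congr_of_eventuallyEq (hev k x hx)
    · have : φ k =ᶠ[𝓝 x] fun _ => 0 := by
        have := notMem_tsupport_iff_eventuallyEq.1 fun h => hx (hsuppU k h)
        exact this
      exact contDiffAt_const.congr_of_eventuallyEq this
  have hgrad : ∀ k, ∇ (φ k) =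
      U.indicator fun x => deriv smoothPosPart (((k : ℝ) + 1) * w x) • ∇ w x := by
    intro k
    funext x
    by_cases hx : x ∈ U
    · rw [indicator_of_mem hx, (hev k x hx).gradient_eq]
      exact (hasGradientAt_comp (hρd k (w x)) (hwd x)).gradient
    · rw [indicator_of_notMem hx]
      exact (htest k).gradient_eq_zero hx
  have hmu : MemLp (U.indicator fun x => max (w x) 0) 2 (volume.restrict Ω) := by
    refine (hmemc M).mono' ?_ (ae_of_all _ fun x => ?_)
    · exact ((hw.continuous.max continuous_const).aestronglyMeasurable).indicator hU.measurableSet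
    · by_cases hx : x ∈ U
      · simp only [indicator_of_mem hx]
        refine le_trans ?_ (hM x (subset_closure hx))
        rw [Real.norm_eq_abs, Real.norm_eq_abs, abs_of_nonneg (le_max_right _ _)]
        exact max_le (le_abs_self _) (abs_nonneg _)
      · simp [indicator_of_notMem hx]
  have hmg : MemLp ((U ∩ {x | 0 < w x}).indicator (∇ w)) 2 (volume.restrict Ω) := by
    refine (hmemc M').mono' ?_ (ae_of_all _ fun x => ?_)
    · exact hgw.aestronglyMeasurable.indicator (hU.inter hW).measurableSet
    · by_cases hx : x ∈ U
      · rw [indicator_of_mem hx]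
        refine (norm_indicator_le_norm_self _ _).trans (hM' x (subset_closure hx))
      · simp [hx]
  refine ⟨hmu, hmg, φ, fun k => (htest k).mono hUΩ, ?_, ?_⟩
  · refine tendsto_eLpNorm_two_of_dominated (fun k => ((htest k).mono hUΩ).memLp.1) hmu.1
      (hmemc (M + M)) (fun k => ae_of_all _ fun x => ?_) (ae_of_all _ fun x => ?_)
    · by_cases hx : x ∈ U
      · simp only [hφ, indicator_of_mem hx]
        have h0 := hM x (subset_closure hx)
        rw [Real.norm_eq_abs] at h0
        refine (norm_sub_le _ _).trans (add_le_add ((hρle k _).trans h0) (le_trans ?_ h0))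
        rw [Real.norm_eq_abs, abs_of_nonneg (le_max_right _ _)]
        exact max_le (le_abs_self _) (abs_nonneg _)
      · simp [hφ, hx]
    · by_cases hx : x ∈ U
      · simp only [hφ, indicator_of_mem hx]
        rcases le_or_gt (w x) 0 with h0 | h0
        · rw [max_eq_right h0]
          refine tendsto_const_nhds.congr fun k => (hρ0 k _ (h0.trans (by positivity))).symm
        · rw [max_eq_left h0.le]
          obtain ⟨N, hN⟩ := exists_nat_gt (2 / w x)
          refine tendsto_const_nhds.congr' ?_
          filter_upwards [eventually_ge_atTop N] with k hk
          have hk' : (N : ℝ) ≤ k := by exact_mod_cast hk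
          have : 2 ≤ ((k : ℝ) + 1) * w x := by
            rw [div_lt_iff₀ h0] at hN
            nlinarith
          simp only [hρ, smoothPosPart_of_ge this]
          have hk : ((k : ℝ) + 1) ≠ 0 := by positivity
          field_simp
      · simp [hφ, hx]
  · refine tendsto_eLpNorm_two_of_dominated (fun k => ((htest k).mono hUΩ).memLp_gradient.1) hmg.1
      (hmemc (C * M' + M')) (fun k => ae_of_all _ fun x => ?_) (ae_of_all _ fun x => ?_)
    · rw [hgrad]
      by_cases hx : x ∈ U
      · have h0 := hM' x (subset_closure hx)
        rw [indicator_of_mem hx, indicator_of_mem hx]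
        refine (norm_sub_le _ _).trans (add_le_add ?_
          ((norm_indicator_le_norm_self _ _).trans h0))
        rw [norm_smul]
        exact mul_le_mul (hC _) h0 (norm_nonneg _) (by linarith)
      · simp [hx]
    · simp only [hgrad]
      by_cases hx : x ∈ U
      · simp only [indicator_of_mem hx]
        -- Where `w = 0` the approximating gradients are already zero, so the level set needs no
        -- separate measure argument.
        rcases le_or_gt (w x) 0 with h0 | h0
        · rw [indicator_of_notMem (fun h => absurd h.2 (not_lt.2 h0))]
          refine tendsto_const_nhds.congr fun k => ?_
          have : ((k : ℝ) + 1) * w x < 1 := by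
            have : ((k : ℝ) + 1) * w x ≤ 0 := mul_nonpos_of_nonneg_of_nonpos (by positivity) h0
            linarith
          rw [deriv_smoothPosPart_of_lt this, zero_smul]
        · have hxw : x ∈ U ∩ {x | 0 < w x} := ⟨hx, h0⟩
          rw [indicator_of_mem hxw]
          obtain ⟨N, hN⟩ := exists_nat_gt (2 / w x)
          refine tendsto_const_nhds.congr' ?_
          filter_upwards [eventually_ge_atTop N] with k hk
          have hk' : (N : ℝ) ≤ k := by exact_mod_cast hk
          have : 2 < ((k : ℝ) + 1) * w x := by
            rw [div_lt_iff₀ h0] at hN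
            nlinarith
          rw [deriv_smoothPosPart_of_gt this, one_smul]
      · simp [hx]

/-- The positive part of a test function. -/
theorem IsTestFunction.hasTestApprox_posPart {Ω : Set (E n)} (hΩ : IsOpen Ω)
    (hb : Bornology.IsBounded Ω) {φ : E n → ℝ} (hφ : IsTestFunction Ω φ) :
    HasTestApprox Ω (fun x => max (φ x) 0) ({x | 0 < φ x}.indicator (∇ φ)) := by
  have h := hasTestApprox_indicator_posPart hΩ hb Subset.rfl hφ.contDiff fun x hx =>
    (hφ.apply_eq_zero (by simpa [hΩ.interior_eq] using hx.2)).le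
  convert h using 1
  · refine (indicator_eq_self.2 fun x hx => ?_).symm
    by_contra h0
    exact hx (by simp [hφ.apply_eq_zero h0])
  · congr 1
    refine (inter_eq_right.2 fun x hx => ?_).symm
    by_contra h0
    exact (ne_of_gt hx) (hφ.apply_eq_zero h0)

/-! ### Lower bounds -/

/-- By symmetry let `q ≤ p`. Then `p m (p + q) = p m (p - q) + 2 m p q`; bound `m` by `l + α` in the
first term and by `τ` in the second, and use `l p ≤ a`. The coefficients of `a` add up to `(p - q) +
q = p`, so `p` can be divided out. -/
theorem le_of_splitting {l τ α m p q a b : ℝ} (hp : 0 ≤ p) (hq : 0 ≤ q) (ha : l * p ≤ a)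
    (hb : l * q ≤ b) (hab : τ * (2 * (p * q)) ≤ q * a + p * b) (hb0 : 0 ≤ b) (ha0 : 0 ≤ a)
    (hm1 : m ≤ l + α) (hm2 : m ≤ τ) : m * (p + q) ≤ a + b + α * |p - q| := by
  have key : ∀ {p q a b : ℝ}, 0 ≤ q → q ≤ p → l * p ≤ a → 0 ≤ b →
      τ * (2 * (p * q)) ≤ q * a + p * b → m * (p + q) ≤ a + b + α * (p - q) := by
    intro p q a b hq hqp ha hb0 hab
    rcases (hq.trans hqp).eq_or_lt with h0 | h0
    · obtain rfl : q = 0 := le_antisymm (h0 ▸ hqp) hq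
      subst h0
      simp only [mul_zero] at *
      linarith
    · refine le_of_mul_le_mul_left ?_ h0
      have h1 : p * (m * (p - q)) ≤ p * ((l + α) * (p - q)) := by
        have := sub_nonneg.2 hqp
        gcongr
      have h2 : (p - q) * (l * p) ≤ (p - q) * a :=
        mul_le_mul_of_nonneg_left ha (sub_nonneg.2 hqp)
      have h3 : m * (2 * (p * q)) ≤ τ * (2 * (p * q)) := by gcongr
      linarith
  rcases le_total q p with h | h
  · rw [abs_of_nonneg (sub_nonneg.2 h)]
    exact key hq h ha hb0 hab
  · rw [abs_sub_comm, abs_of_nonneg (sub_nonneg.2 h)]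
    have := key (p := q) (q := p) (a := b) (b := a) hp h hb ha0 (by linarith [mul_comm p q])
    linarith

theorem integrable_abs_sq {α : Type*} [MeasurableSpace α] {μ : Measure α} {u : α → ℝ}
    (hu : MemLp u 2 μ) : Integrable (fun x => |u x| ^ 2) μ :=
  (memLp_two_iff_integrable_sq_norm hu.1).1 hu

theorem integrable_norm_sq {α V : Type*} [MeasurableSpace α] [NormedAddCommGroup V]
    {μ : Measure α} {u : α → V} (hu : MemLp u 2 μ) : Integrable (fun x => ‖u x‖ ^ 2) μ :=
  (memLp_two_iff_integrable_sq_norm hu.1).1 hu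

/-- All three integrals are continuous along the approximation, so lower bounds need only be proved
for test functions. -/
theorem HasTestApprox.le_of_forall_isTestFunction {Ω : Set (E n)} {m α : ℝ}
    (h : ∀ φ, IsTestFunction Ω φ → m * ∫ x in Ω, |φ x| ^ 2 ≤
      (∫ x in Ω, ‖∇ φ x‖ ^ 2) + α * |∫ x in Ω, |φ x| * φ x|)
    {u : E n → ℝ} {g : E n → E n} (hu : HasTestApprox Ω u g) :
    m * ∫ x in Ω, |u x| ^ 2 ≤ (∫ x in Ω, ‖g x‖ ^ 2) + α * |∫ x in Ω, |u x| * u x| := by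
  obtain ⟨φ, hφ, h1, h2, h3⟩ := hu.exists_tendsto_integral
  exact le_of_tendsto_of_tendsto' (h1.const_mul m) (h3.add (h2.abs.const_mul α))
    fun k => h _ (hφ k)

/-- The functional with the nonlocal term is bounded below by `min (λ + α) τ` if the Dirichlet
integral is bounded below by `λ`, and by `τ` under the constraint: along the functions
`c u⁺ - d u⁻` the quotient is piecewise affine in `c² ∫ |u⁺|²`. -/
theorem IsTestFunction.le_dirichlet_add {Ω : Set (E n)} (hΩ : IsOpen Ω)
    (hb : Bornology.IsBounded Ω) {l τ α m : ℝ}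
    (h1 : ∀ u g, HasTestApprox Ω u g → l * ∫ x in Ω, |u x| ^ 2 ≤ ∫ x in Ω, ‖g x‖ ^ 2)
    (h2 : ∀ u g, HasTestApprox Ω u g → ∫ x in Ω, |u x| * u x = 0 →
      τ * ∫ x in Ω, |u x| ^ 2 ≤ ∫ x in Ω, ‖g x‖ ^ 2)
    (hm1 : m ≤ l + α) (hm2 : m ≤ τ) {φ : E n → ℝ} (hφ : IsTestFunction Ω φ) :
    m * ∫ x in Ω, |φ x| ^ 2 ≤
      (∫ x in Ω, ‖∇ φ x‖ ^ 2) + α * |∫ x in Ω, |φ x| * φ x| := by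
  have hP := hφ.hasTestApprox_posPart hΩ hb
  have hN := (hφ.const_mul (-1)).hasTestApprox_posPart hΩ hb
  set u₁ : E n → ℝ := fun x => max (φ x) 0 with hu₁
  set u₂ : E n → ℝ := fun x => max (-1 * φ x) 0 with hu₂
  set g₁ : E n → E n := {x | 0 < φ x}.indicator (∇ φ) with hg₁
  set g₂ : E n → E n := {x | 0 < -1 * φ x}.indicator (∇ fun x => -1 * φ x) with hg₂
  have cases3 : ∀ x, (0 < φ x ∧ u₁ x = φ x ∧ u₂ x = 0 ∧ g₁ x = ∇ φ x ∧ g₂ x = 0) ∨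
      (φ x < 0 ∧ u₁ x = 0 ∧ u₂ x = -φ x ∧ g₁ x = 0 ∧ g₂ x = -∇ φ x) ∨
      (φ x = 0 ∧ u₁ x = 0 ∧ u₂ x = 0 ∧ g₁ x = 0 ∧ g₂ x = 0) := by
    intro x
    rcases lt_trichotomy (φ x) 0 with h | h | h
    · refine Or.inr (Or.inl ⟨h, ?_⟩)
      have e : ∇ (fun x => -φ x) x = -∇ φ x := by simpa using hφ.gradient_const_mul (-1) x
      simp [hu₁, hu₂, hg₁, hg₂, h, h.le, h.not_gt, e]
    · refine Or.inr (Or.inr ⟨h, ?_⟩)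
      simp [hu₁, hu₂, hg₁, hg₂, h]
    · refine Or.inl ⟨h, ?_⟩
      simp [hu₁, hu₂, hg₁, hg₂, h, h.le, h.not_gt]
  set p := ∫ x in Ω, |u₁ x| ^ 2 with hp
  set q := ∫ x in Ω, |u₂ x| ^ 2 with hq
  set a := ∫ x in Ω, ‖g₁ x‖ ^ 2 with ha
  set b := ∫ x in Ω, ‖g₂ x‖ ^ 2 with hbdef
  have ip := integrable_abs_sq hP.memLp
  have iq := integrable_abs_sq hN.memLp
  have ia := integrable_norm_sq hP.memLp_grad
  have ib := integrable_norm_sq hN.memLp_grad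
  have p0 : 0 ≤ p := integral_nonneg fun x => by positivity
  have q0 : 0 ≤ q := integral_nonneg fun x => by positivity
  have e1 : ∫ x in Ω, |φ x| ^ 2 = p + q := by
    rw [hp, hq, ← integral_add ip iq]
    refine integral_congr_ae (ae_of_all _ fun x => ?_)
    rcases cases3 x with ⟨_, h1, h2, _⟩ | ⟨_, h1, h2, _⟩ | ⟨h0, h1, h2, _⟩
    · simp [h1, h2]
    · simp [h1, h2]
    · simp [h0, h1, h2]
  have e2 : ∫ x in Ω, |φ x| * φ x = p - q := by
    rw [hp, hq, ← integral_sub ip iq]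
    refine integral_congr_ae (ae_of_all _ fun x => ?_)
    rcases cases3 x with ⟨h0, h1, h2, _⟩ | ⟨h0, h1, h2, _⟩ | ⟨h0, h1, h2, _⟩
    · simp only [h1, h2, abs_of_pos h0]; simp; ring
    · simp only [h1, h2, abs_of_neg h0]; simp; ring
    · simp [h0, h1, h2]
  -- Both gradients are set to zero on `{φ = 0}`, so the inequality is immediate, and equality is
  -- not needed.
  have e3 : a + b ≤ ∫ x in Ω, ‖∇ φ x‖ ^ 2 := by
    rw [ha, hbdef, ← integral_add ia ib]
    refine integral_mono_ae (ia.add ib) (integrable_norm_sq hφ.memLp_gradient)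
      (ae_of_all _ fun x => ?_)
    rcases cases3 x with ⟨h0, _, _, h1, h2⟩ | ⟨h0, _, _, h1, h2⟩ | ⟨h0, _, _, h1, h2⟩
    all_goals simp [h1, h2]
  -- The weights give both parts the mass `p q`, so the combination satisfies the constraint.
  have hcomb := (hP.const_mul √q).add (hN.const_mul (-√p))
  have c1 : ∫ x in Ω, |√q * u₁ x + -√p * u₂ x| ^ 2 = 2 * (p * q) := by
    have : ∀ x, |√q * u₁ x + -√p * u₂ x| ^ 2 = q * |u₁ x| ^ 2 + p * |u₂ x| ^ 2 := by
      intro x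
      rcases cases3 x with ⟨h0, h1, h2, _⟩ | ⟨h0, h1, h2, _⟩ | ⟨h0, h1, h2, _⟩
      all_goals simp [h1, h2, mul_pow, Real.sq_sqrt p0, Real.sq_sqrt q0]
    simp only [this]
    rw [integral_add (ip.const_mul q) (iq.const_mul p), integral_const_mul, integral_const_mul,
      ← hp, ← hq]
    ring
  have c2 : ∫ x in Ω, |√q * u₁ x + -√p * u₂ x| * (√q * u₁ x + -√p * u₂ x) = 0 := by
    have : ∀ x, |√q * u₁ x + -√p * u₂ x| * (√q * u₁ x + -√p * u₂ x) =
        q * |u₁ x| ^ 2 - p * |u₂ x| ^ 2 := by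
      intro x
      rcases cases3 x with ⟨h0, h1, h2, _⟩ | ⟨h0, h1, h2, _⟩ | ⟨h0, h1, h2, _⟩
      · simp only [h1, h2, mul_zero, add_zero, abs_mul, abs_of_pos h0,
          abs_of_nonneg (Real.sqrt_nonneg q)]
        linear_combination (φ x) ^ 2 * Real.mul_self_sqrt q0
      · simp only [h1, h2, mul_zero, zero_add, abs_mul, abs_neg, abs_of_neg h0,
          abs_of_nonneg (Real.sqrt_nonneg p)]
        simp only [abs_zero]
        linear_combination -(φ x) ^ 2 * Real.mul_self_sqrt p0
      · simp [h1, h2]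
    simp only [this]
    rw [integral_sub (ip.const_mul q) (iq.const_mul p), integral_const_mul, integral_const_mul,
      ← hp, ← hq]
    ring
  have c3 : ∫ x in Ω, ‖√q • g₁ x + -√p • g₂ x‖ ^ 2 = q * a + p * b := by
    have : ∀ x, ‖√q • g₁ x + -√p • g₂ x‖ ^ 2 = q * ‖g₁ x‖ ^ 2 + p * ‖g₂ x‖ ^ 2 := by
      intro x
      rcases cases3 x with ⟨h0, _, _, h1, h2⟩ | ⟨h0, _, _, h1, h2⟩ | ⟨h0, _, _, h1, h2⟩
      all_goals simp [h1, h2, norm_smul, mul_pow, Real.sq_sqrt p0, Real.sq_sqrt q0]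
    simp only [this]
    rw [integral_add (ia.const_mul q) (ib.const_mul p), integral_const_mul, integral_const_mul]
  have h3 := h2 _ _ hcomb c2
  rw [c1, c3] at h3
  have := le_of_splitting (α := α) p0 q0 (h1 _ _ hP) (h1 _ _ hN) h3
    (integral_nonneg fun x => by positivity) (integral_nonneg fun x => by positivity) hm1 hm2
  rw [e1, e2]
  linarith

/-! ### Compactness -/

open scoped SchwartzMap FourierTransform LineDeriv

/-- A test function as a complex-valued Schwartz function. -/
def IsTestFunction.toSchwartz {Ω : Set (E n)} {φ : E n → ℝ} (hφ : IsTestFunction Ω φ) :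
    𝓢(E n, ℂ) :=
  HasCompactSupport.toSchwartzMap (f := fun x => (φ x : ℂ))
    (hφ.hasCompactSupport.comp_left (g := fun t : ℝ => (t : ℂ)) Complex.ofReal_zero)
    (Complex.ofRealCLM.contDiff.comp hφ.contDiff)

namespace IsTestFunction

variable {Ω : Set (E n)} {φ : E n → ℝ}

theorem toSchwartz_apply (hφ : IsTestFunction Ω φ) (x : E n) : hφ.toSchwartz x = φ x := rfl

theorem integral_norm_sq_fourier (hφ : IsTestFunction Ω φ) :
    ∫ ξ, ‖𝓕 hφ.toSchwartz ξ‖ ^ 2 = ∫ x in Ω, |φ x| ^ 2 := by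
  rw [SchwartzMap.integral_norm_sq_fourier,
    setIntegral_eq_integral_of_forall_compl_eq_zero (fun x hx => by simp [hφ.apply_eq_zero hx])]
  simp [toSchwartz_apply]

/-- The partial derivatives of a test function as Schwartz functions. -/
def partialDeriv (hφ : IsTestFunction Ω φ) (i : Fin n) : 𝓢(E n, ℂ) :=
  ∂_{EuclideanSpace.single i (1 : ℝ)} hφ.toSchwartz

theorem partialDeriv_apply (hφ : IsTestFunction Ω φ) (i : Fin n) (x : E n) :
    hφ.partialDeriv i x = (((∇ φ x) i : ℝ) : ℂ) := by
  rw [partialDeriv, SchwartzMap.lineDerivOp_apply_eq_fderiv]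
  have h : HasFDerivAt hφ.toSchwartz (Complex.ofRealCLM.comp (fderiv ℝ φ x)) x :=
    Complex.ofRealCLM.hasFDerivAt.comp x (hφ.differentiable x).hasFDerivAt
  rw [h.fderiv]
  have := inner_gradient_left (f := φ) (x := x) (y := EuclideanSpace.single i (1 : ℝ))
  simp only [ContinuousLinearMap.comp_apply, ← this]
  rw [EuclideanSpace.inner_single_right] at this
  simpa using this.symm

/-- The Fourier transform turns `∂_i` into multiplication by `2πi ξ_i`. -/
theorem sum_norm_fourier_partialDeriv_sq (hφ : IsTestFunction Ω φ) (ξ : E n) :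
    ∑ i, ‖𝓕 (hφ.partialDeriv i) ξ‖ ^ 2 =
      (2 * Real.pi) ^ 2 * (‖ξ‖ ^ 2 * ‖𝓕 hφ.toSchwartz ξ‖ ^ 2) := by
  rw [EuclideanSpace.norm_sq_eq, Finset.sum_mul, Finset.mul_sum]
  refine Finset.sum_congr rfl fun i _ => ?_
  rw [partialDeriv, SchwartzMap.fourier_lineDerivOp_eq]
  have : (inner ℝ · (EuclideanSpace.single i (1 : ℝ)) : E n → ℝ).HasTemperateGrowth := by fun_prop
  rw [smul_apply, SchwartzMap.smulLeftCLM_apply_apply this, norm_smul, norm_smul]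
  simp only [EuclideanSpace.inner_single_right, Complex.norm_mul, Complex.norm_I, mul_one]
  simp [abs_of_pos Real.pi_pos, mul_pow, mul_assoc]

theorem integrable_norm_sq_schwartz (f : 𝓢(E n, ℂ)) : Integrable fun x => ‖f x‖ ^ 2 :=
  (memLp_two_iff_integrable_sq_norm f.continuous.aestronglyMeasurable).1 (f.memLp 2)

theorem integral_sum_norm_fourier_sq (hφ : IsTestFunction Ω φ) :
    ∫ ξ, ∑ i, ‖𝓕 (hφ.partialDeriv i) ξ‖ ^ 2 =
      ∫ x in Ω, ‖∇ φ x‖ ^ 2 := by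
  rw [integral_finsetSum _ fun i _ => integrable_norm_sq_schwartz _]
  simp only [SchwartzMap.integral_norm_sq_fourier]
  rw [← integral_finsetSum _ fun i _ => integrable_norm_sq_schwartz _,
    setIntegral_eq_integral_of_forall_compl_eq_zero (fun x hx => by simp [hφ.gradient_eq_zero hx])]
  refine integral_congr_ae (ae_of_all _ fun x => ?_)
  simp only [hφ.partialDeriv_apply, Complex.norm_real]
  rw [EuclideanSpace.norm_sq_eq]

/-- High frequencies of a test function are controlled by its gradient. -/
theorem integral_abs_sq_le (hφ : IsTestFunction Ω φ) {M : ℝ} (hM : 0 < M) :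
    ∫ x in Ω, |φ x| ^ 2 ≤ (∫ ξ in Metric.ball 0 M, ‖𝓕 hφ.toSchwartz ξ‖ ^ 2) +
      (M ^ 2)⁻¹ * ∫ x in Ω, ‖∇ φ x‖ ^ 2 := by
  rw [← hφ.integral_norm_sq_fourier, ← hφ.integral_sum_norm_fourier_sq,
    ← integral_indicator measurableSet_ball, ← integral_const_mul]
  have i1 := integrable_norm_sq_schwartz (𝓕 hφ.toSchwartz)
  have i2 := i1.indicator (measurableSet_ball (x := (0 : E n)) (ε := M))
  have i3 : Integrable fun ξ =>
      ∑ i, ‖𝓕 (hφ.partialDeriv i) ξ‖ ^ 2 :=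
    integrable_finsetSum _ fun i _ => integrable_norm_sq_schwartz _
  rw [← integral_add i2 (i3.const_mul _)]
  refine integral_mono i1 (i2.add (i3.const_mul _)) fun ξ => ?_
  simp only [hφ.sum_norm_fourier_partialDeriv_sq]
  by_cases hξ : ξ ∈ Metric.ball (0 : E n) M
  · rw [indicator_of_mem hξ]
    exact le_add_of_nonneg_right (by positivity)
  · rw [indicator_of_notMem hξ, zero_add]
    have h1 : M ≤ ‖ξ‖ := by simpa using hξ
    have h2 : 1 ≤ (2 * Real.pi) ^ 2 := one_le_pow₀ (by linarith [Real.pi_gt_three])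
    have h3 : 1 ≤ (M ^ 2)⁻¹ * ‖ξ‖ ^ 2 := by
      rw [inv_mul_eq_div, one_le_div (by positivity)]
      gcongr
    calc ‖𝓕 hφ.toSchwartz ξ‖ ^ 2 = 1 * 1 * ‖𝓕 hφ.toSchwartz ξ‖ ^ 2 := by ring
      _ ≤ (2 * Real.pi) ^ 2 * ((M ^ 2)⁻¹ * ‖ξ‖ ^ 2) * ‖𝓕 hφ.toSchwartz ξ‖ ^ 2 := by gcongr
      _ = _ := by ring

/-- The real form exhibits each Fourier value as pairings of `φ` with bounded functions on `Ω`, to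
which weak convergence applies. -/
theorem fourier_toSchwartz_apply (hφ : IsTestFunction Ω φ) (ξ : E n) :
    𝓕 hφ.toSchwartz ξ =
      ((∫ x in Ω, φ x * Real.cos (2 * Real.pi * inner ℝ x ξ) : ℝ) : ℂ) -
        ((∫ x in Ω, φ x * Real.sin (2 * Real.pi * inner ℝ x ξ) : ℝ) : ℂ) * Complex.I := by
  rw [SchwartzMap.fourier_coe, Real.fourier_eq']
  have hc : ∀ (c : ℝ → ℝ), Continuous c →
      Integrable fun x => φ x * c (2 * Real.pi * inner ℝ x ξ) := fun c hc =>
    (hφ.contDiff.continuous.mul (hc.comp (by fun_prop))).integrable_of_hasCompactSupport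
      hφ.hasCompactSupport.mul_right
  rw [setIntegral_eq_integral_of_forall_compl_eq_zero (fun x hx => by simp [hφ.apply_eq_zero hx]),
    setIntegral_eq_integral_of_forall_compl_eq_zero (fun x hx => by simp [hφ.apply_eq_zero hx]),
    ← integral_complex_ofReal, ← integral_complex_ofReal, ← integral_mul_const,
    ← integral_sub (hc _ Real.continuous_cos).ofReal
      ((hc _ Real.continuous_sin).ofReal.mul_const _)]
  refine integral_congr_ae (ae_of_all _ fun x => ?_)
  simp only [toSchwartz_apply, smul_eq_mul]
  rw [Complex.exp_mul_I, ← Complex.ofReal_cos, ← Complex.ofReal_sin]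
  have : -2 * Real.pi * inner ℝ x ξ = -(2 * Real.pi * inner ℝ x ξ) := by ring
  rw [this, Real.cos_neg, Real.sin_neg]
  push_cast
  ring

end IsTestFunction

/-- A bounded sequence in a separable Hilbert space has a weakly convergent subsequence. -/
theorem exists_weak_limit {H : Type*} [NormedAddCommGroup H] [InnerProductSpace ℝ H]
    [CompleteSpace H] [TopologicalSpace.SeparableSpace H] {x : ℕ → H} {C : ℝ}
    (hx : ∀ k, ‖x k‖ ≤ C) : ∃ (h : H) (σ : ℕ → ℕ), StrictMono σ ∧
      ∀ y, Tendsto (fun k => inner ℝ (x (σ k)) y) atTop (𝓝 (inner ℝ h y)) := by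
  obtain ⟨a, -, σ, hσ, hlim⟩ := WeakDual.isSeqCompact_closedBall ℝ H 0 C
    (x := fun k => StrongDual.toWeakDual (InnerProductSpace.toDual ℝ H (x k)))
    (fun k => by simpa using hx k)
  refine ⟨(InnerProductSpace.toDual ℝ H).symm (WeakDual.toStrongDual a), σ, hσ, fun y => ?_⟩
  have := ((WeakDual.eval_continuous y).tendsto a).comp hlim
  simpa [Function.comp_def] using this

theorem integral_norm_sub_sq_le {α V : Type*} [MeasurableSpace α] {μ : Measure α}
    [NormedAddCommGroup V] {a b : α → V} (ha : MemLp a 2 μ) (hb : MemLp b 2 μ) :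
    ∫ x, ‖a x - b x‖ ^ 2 ∂μ ≤ 2 * (∫ x, ‖a x‖ ^ 2 ∂μ) + 2 * ∫ x, ‖b x‖ ^ 2 ∂μ := by
  have ia := (integrable_norm_sq ha).const_mul 2
  have ib := (integrable_norm_sq hb).const_mul 2
  rw [← integral_const_mul, ← integral_const_mul, ← integral_add ia ib]
  refine integral_mono (integrable_norm_sq (ha.sub hb)) (ia.add ib) fun x => ?_
  have h1 := norm_sub_le (a x) (b x)
  have h2 : ‖a x - b x‖ ^ 2 ≤ (‖a x‖ + ‖b x‖) ^ 2 := by gcongr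
  change ‖a x - b x‖ ^ 2 ≤ 2 * ‖a x‖ ^ 2 + 2 * ‖b x‖ ^ 2
  nlinarith [sq_nonneg (‖a x‖ - ‖b x‖)]

/-- By `|φ| ≤ |φ|² + 1` on a set of finite measure; uniformity in `ξ` provides the dominating
constant in Rellich's theorem. -/
theorem IsTestFunction.norm_fourier_le {Ω : Set (E n)} (hfin : volume Ω ≠ ⊤) {φ : E n → ℝ}
    (hφ : IsTestFunction Ω φ) (ξ : E n) :
    ‖𝓕 hφ.toSchwartz ξ‖ ≤ 2 * ((∫ x in Ω, |φ x| ^ 2) + volume.real Ω) := by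
  have hfinm : IsFiniteMeasure (volume.restrict Ω) := ⟨by simpa using hfin.lt_top⟩
  have i2 := integrable_abs_sq hφ.memLp
  have key : ∀ c : ℝ → ℝ, (∀ t, |c t| ≤ 1) →
      |∫ x in Ω, φ x * c (2 * Real.pi * inner ℝ x ξ)| ≤
        (∫ x in Ω, |φ x| ^ 2) + volume.real Ω := by
    intro c hc
    have e : (∫ x in Ω, |φ x| ^ 2) + volume.real Ω = ∫ x in Ω, (|φ x| ^ 2 + 1) := by
      rw [integral_add i2 (integrable_const _)]; simp
    rw [e, ← Real.norm_eq_abs]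
    refine norm_integral_le_of_norm_le (i2.add (integrable_const _)) (ae_of_all _ fun x => ?_)
    rw [norm_mul, Real.norm_eq_abs, Real.norm_eq_abs]
    have h1 : |φ x| * |c (2 * Real.pi * inner ℝ x ξ)| ≤ |φ x| :=
      mul_le_of_le_one_right (abs_nonneg _) (hc _)
    change _ ≤ |φ x| ^ 2 + 1
    nlinarith [sq_nonneg (|φ x| - 1 / 2)]
  rw [hφ.fourier_toSchwartz_apply]
  refine (norm_sub_le _ _).trans ?_
  rw [Complex.norm_mul, Complex.norm_I, mul_one, Complex.norm_real, Complex.norm_real,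
    two_mul (_ + volume.real Ω)]
  exact add_le_add (key _ Real.abs_cos_le_one) (key _ Real.abs_sin_le_one)

/-- **Rellich's theorem**: a weakly convergent sequence of test functions with bounded Dirichlet
integrals is a Cauchy sequence in `L²`. -/
theorem tendsto_integral_sub_sq {Ω : Set (E n)} (hfin : volume Ω ≠ ⊤) {φ : ℕ → E n → ℝ}
    (hφ : ∀ k, IsTestFunction Ω (φ k)) {C : ℝ} (hC : ∀ k, ∫ x in Ω, |φ k x| ^ 2 ≤ C)
    (hD : ∀ k, ∫ x in Ω, ‖∇ (φ k) x‖ ^ 2 ≤ C)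
    (hw : ∀ y : E n → ℝ, MemLp y 2 (volume.restrict Ω) →
      ∃ L, Tendsto (fun k => ∫ x in Ω, φ k x * y x) atTop (𝓝 L)) :
    Tendsto (fun p : ℕ × ℕ => ∫ x in Ω, |φ p.1 x - φ p.2 x| ^ 2) atTop (𝓝 0) := by
  have hfinm : IsFiniteMeasure (volume.restrict Ω) := ⟨by simpa using hfin.lt_top⟩
  have hd : ∀ p : ℕ × ℕ, IsTestFunction Ω fun x => φ p.1 x + -1 * φ p.2 x :=
    fun p => (hφ p.1).add ((hφ p.2).const_mul (-1))
  have hdx : ∀ (p : ℕ × ℕ) x, φ p.1 x + -1 * φ p.2 x = φ p.1 x - φ p.2 x := fun p x => by ring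
  have hC' : ∀ p : ℕ × ℕ, ∫ x in Ω, |φ p.1 x + -1 * φ p.2 x| ^ 2 ≤ 4 * C := by
    intro p
    simp only [hdx]
    have := integral_norm_sub_sq_le (hφ p.1).memLp (hφ p.2).memLp
    simp only [Real.norm_eq_abs] at this
    linarith [hC p.1, hC p.2]
  have hD' : ∀ p : ℕ × ℕ, ∫ x in Ω, ‖∇ (fun x => φ p.1 x + -1 * φ p.2 x) x‖ ^ 2 ≤ 4 * C := by
    intro p
    have e : ∀ x, ∇ (fun x => φ p.1 x + -1 * φ p.2 x) x = ∇ (φ p.1) x - ∇ (φ p.2) x := by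
      intro x
      rw [(hφ p.1).gradient_add ((hφ p.2).const_mul (-1)), (hφ p.2).gradient_const_mul (-1)]
      simp [sub_eq_add_neg]
    simp only [e]
    have := integral_norm_sub_sq_le (hφ p.1).memLp_gradient (hφ p.2).memLp_gradient
    linarith [hD p.1, hD p.2]
  -- pointwise convergence of the Fourier transforms
  have hpair : ∀ y : E n → ℝ, Continuous y → (∀ x, |y x| ≤ 1) →
      Tendsto (fun p : ℕ × ℕ => ∫ x in Ω, (φ p.1 x + -1 * φ p.2 x) * y x) atTop (𝓝 0) := by
    intro y hy hy1
    have hmem : MemLp y 2 (volume.restrict Ω) :=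
      MemLp.of_bound hy.aestronglyMeasurable 1 (ae_of_all _ hy1)
    obtain ⟨L, hL⟩ := hw y hmem
    have h1 : Tendsto (fun p : ℕ × ℕ => (∫ x in Ω, φ p.1 x * y x) - ∫ x in Ω, φ p.2 x * y x)
        atTop (𝓝 (L - L)) := by
      rw [← prod_atTop_atTop_eq]
      exact (hL.comp tendsto_fst).sub (hL.comp tendsto_snd)
    rw [sub_self] at h1
    refine h1.congr fun p => ?_
    rw [← integral_sub (hmem.integrable_mul (hφ p.1).memLp |>.congr
        (ae_of_all _ fun x => mul_comm _ _)) (hmem.integrable_mul (hφ p.2).memLp |>.congr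
        (ae_of_all _ fun x => mul_comm _ _))]
    refine integral_congr_ae (ae_of_all _ fun x => ?_)
    simp only [hdx, sub_mul]
  have hpt : ∀ ξ, Tendsto (fun p => 𝓕 (hd p).toSchwartz ξ) atTop (𝓝 0) := by
    intro ξ
    simp only [IsTestFunction.fourier_toSchwartz_apply]
    have h1 := hpair (fun x => Real.cos (2 * Real.pi * inner ℝ x ξ)) (by fun_prop)
      fun x => Real.abs_cos_le_one _
    have h2 := hpair (fun x => Real.sin (2 * Real.pi * inner ℝ x ξ)) (by fun_prop)
      fun x => Real.abs_sin_le_one _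
    have h3 := ((Complex.continuous_ofReal.tendsto _).comp h1).sub
      (((Complex.continuous_ofReal.tendsto _).comp h2).mul_const Complex.I)
    simpa [Function.comp_def] using h3
  -- Low frequencies: pointwise convergence with a uniform bound on a ball of finite measure.
  have hball : ∀ M : ℝ, Tendsto
      (fun p => ∫ ξ in Metric.ball (0 : E n) M, ‖𝓕 (hd p).toSchwartz ξ‖ ^ 2) atTop (𝓝 0) := by
    intro M
    have hfb : IsFiniteMeasure (volume.restrict (Metric.ball (0 : E n) M)) :=
      ⟨by simpa using measure_ball_lt_top⟩
    have := tendsto_integral_filter_of_dominated_convergence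
      (μ := volume.restrict (Metric.ball (0 : E n) M)) (l := (atTop : Filter (ℕ × ℕ)))
      (F := fun p ξ => ‖𝓕 (hd p).toSchwartz ξ‖ ^ 2) (f := fun _ => (0 : ℝ))
      (fun _ => (2 * (4 * C + volume.real Ω)) ^ 2)
      (Eventually.of_forall fun p =>
        ((𝓕 (hd p).toSchwartz).continuous.norm.pow 2).aestronglyMeasurable)
      (Eventually.of_forall fun p => ae_of_all _ fun ξ => ?_) (integrable_const _)
      (ae_of_all _ fun ξ => by simpa using (hpt ξ).norm.pow 2)
    · simpa using this
    · rw [norm_pow, norm_norm]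
      have h1 := (hd p).norm_fourier_le hfin ξ
      have h2 := hC' p
      gcongr
      linarith
  simp only [← hdx]
  rw [Metric.tendsto_nhds]
  intro ε hε
  -- `M` makes the high frequencies of every difference smaller than `ε / 2` at once.
  obtain ⟨M, hM, hM'⟩ : ∃ M : ℝ, 0 < M ∧ (M ^ 2)⁻¹ * (4 * C) < ε / 2 := by
    have ht : Tendsto (fun M : ℝ => (M ^ 2)⁻¹ * (4 * C)) atTop (𝓝 (0 * (4 * C))) :=
      ((tendsto_pow_atTop two_ne_zero).inv_tendsto_atTop).mul_const _
    rw [zero_mul] at ht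
    exact ((eventually_gt_atTop 0).and (ht.eventually (gt_mem_nhds (half_pos hε)))).exists
  filter_upwards [(hball M).eventually (gt_mem_nhds (half_pos hε))] with p hp
  rw [dist_zero_right, Real.norm_eq_abs, abs_of_nonneg (integral_nonneg fun x => by positivity)]
  have h1 := (hd p).integral_abs_sq_le hM
  have h2 : (M ^ 2)⁻¹ * ∫ x in Ω, ‖∇ (fun x => φ p.1 x + -1 * φ p.2 x) x‖ ^ 2 ≤
      (M ^ 2)⁻¹ * (4 * C) := mul_le_mul_of_nonneg_left (hD' p) (by positivity)
  linarith

theorem Lp_norm_sq {α V : Type*} [MeasurableSpace α] {μ : Measure α} [NormedAddCommGroup V]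
    [InnerProductSpace ℝ V] (f : Lp V 2 μ) : ‖f‖ ^ 2 = ∫ x, ‖f x‖ ^ 2 ∂μ := by
  rw [← real_inner_self_eq_norm_sq, L2.inner_def]
  simp

theorem MemLp.norm_toLp_sq {α V : Type*} [MeasurableSpace α] {μ : Measure α}
    [NormedAddCommGroup V] [InnerProductSpace ℝ V] {f : α → V} (hf : MemLp f 2 μ) :
    ‖hf.toLp f‖ ^ 2 = ∫ x, ‖f x‖ ^ 2 ∂μ := by
  rw [Lp_norm_sq]
  refine integral_congr_ae ?_
  filter_upwards [hf.coeFn_toLp] with x hx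
  rw [hx]

/-- The Hilbert space `L²(Ω) × L²(Ω; ℝⁿ)`. -/
abbrev PairSpace (Ω : Set (E n)) :=
  WithLp 2 (Lp ℝ 2 (volume.restrict Ω) × Lp (E n) 2 (volume.restrict Ω))

/-- The pair `(φ, ∇ φ)` of a test function. -/
def IsTestFunction.toPair {Ω : Set (E n)} {φ : E n → ℝ} (hφ : IsTestFunction Ω φ) :
    PairSpace Ω :=
  WithLp.toLp 2 (hφ.memLp.toLp φ, hφ.memLp_gradient.toLp (∇ φ))

/-- The subspace of the pairs `(φ, ∇ φ)` of test functions. -/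
def testPairs (Ω : Set (E n)) : Submodule ℝ (PairSpace Ω) where
  carrier := {p | ∃ (φ : E n → ℝ) (hφ : IsTestFunction Ω φ), hφ.toPair = p}
  add_mem' := by
    rintro _ _ ⟨φ, hφ, rfl⟩ ⟨ψ, hψ, rfl⟩
    refine ⟨_, hφ.add hψ, ?_⟩
    simp only [IsTestFunction.toPair]
    rw [← WithLp.toLp_add, Prod.mk_add_mk, ← MemLp.toLp_add, ← MemLp.toLp_add]
    congr 2
    rw [MemLp.toLp_eq_toLp_iff]
    exact ae_of_all _ fun x => hφ.gradient_add hψ x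
  zero_mem' := by
    have h0 : IsTestFunction Ω fun _ => 0 :=
      ⟨contDiff_const, HasCompactSupport.zero, by simp [tsupport]⟩
    refine ⟨_, h0, ?_⟩
    simp only [IsTestFunction.toPair]
    rw [← WithLp.toLp_zero, ← Prod.mk_zero_zero]
    congr 2
    rw [← MemLp.toLp_zero (MemLp.zero' (p := 2) (ε := E n)), MemLp.toLp_eq_toLp_iff]
    exact ae_of_all _ fun x => by simp [gradient]
  smul_mem' := by
    rintro c _ ⟨φ, hφ, rfl⟩
    refine ⟨_, hφ.const_mul c, ?_⟩
    simp only [IsTestFunction.toPair]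
    rw [← WithLp.toLp_smul, Prod.smul_mk, ← MemLp.toLp_const_smul, ← MemLp.toLp_const_smul]
    congr 2
    rw [MemLp.toLp_eq_toLp_iff]
    exact ae_of_all _ fun x => hφ.gradient_const_mul c x

/-- Convergence in the product Hilbert space is `L²` convergence of the functions together with
their gradients. -/
theorem hasTestApprox_of_mem_closure {Ω : Set (E n)} {h : PairSpace Ω}
    (hh : h ∈ (testPairs Ω).topologicalClosure) : HasTestApprox Ω h.fst h.snd := by
  obtain ⟨p, hp, hlim⟩ := mem_closure_iff_seq_limit.1 hh
  choose φ hφ hpφ using hp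
  have hc1 : Continuous fun q : PairSpace Ω => q.fst := WithLp.continuous_fst ..
  have hc2 : Continuous fun q : PairSpace Ω => q.snd := WithLp.continuous_snd ..
  have h1 := (hc1.tendsto h).comp hlim
  have h2 := (hc2.tendsto h).comp hlim
  have e1 : ∀ k, (p k).fst = (hφ k).memLp.toLp (φ k) := fun k => by rw [← hpφ k]; rfl
  have e2 : ∀ k, (p k).snd = (hφ k).memLp_gradient.toLp (∇ (φ k)) := fun k => by
    rw [← hpφ k]; rfl
  refine ⟨Lp.memLp _, Lp.memLp _, φ, hφ, ?_, ?_⟩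
  · refine (Lp.tendsto_Lp_iff_tendsto_eLpNorm'' φ (fun k => (hφ k).memLp) h.fst
      (Lp.memLp _)).1 ?_
    simpa [Function.comp_def, e1] using h1
  · refine (Lp.tendsto_Lp_iff_tendsto_eLpNorm'' (fun k => ∇ (φ k))
      (fun k => (hφ k).memLp_gradient) h.snd (Lp.memLp _)).1 ?_
    simpa [Function.comp_def, e2] using h2

theorem separableSpace_pairSpace (Ω : Set (E n)) :
    TopologicalSpace.SeparableSpace (PairSpace Ω) := by
  have hp : Fact ((2 : ℝ≥0∞) ≠ ⊤) := ⟨by simp⟩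
  have h1 : SecondCountableTopology (Lp ℝ 2 (volume.restrict Ω)) := Lp.SecondCountableTopology
  have h2 : SecondCountableTopology (Lp (E n) 2 (volume.restrict Ω)) :=
    Lp.SecondCountableTopology
  have h3 : SecondCountableTopology (PairSpace Ω) :=
    (WithLp.homeomorphProd 2 (Lp ℝ 2 (volume.restrict Ω))
      (Lp (E n) 2 (volume.restrict Ω))).secondCountableTopology
  infer_instance

/-- Weak compactness of `W₀^{1,2}(Ω)` together with Rellich's theorem. -/
theorem exists_limit_of_bounded {Ω : Set (E n)} (hfin : volume Ω ≠ ⊤)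
    {φ : ℕ → E n → ℝ} (hφ : ∀ k, IsTestFunction Ω (φ k)) {C τ : ℝ}
    (hC : ∀ k, ∫ x in Ω, |φ k x| ^ 2 ≤ C)
    (hτ : Tendsto (fun k => ∫ x in Ω, ‖∇ (φ k) x‖ ^ 2) atTop (𝓝 τ)) :
    ∃ (u : E n → ℝ) (g : E n → E n) (σ : ℕ → ℕ), HasTestApprox Ω u g ∧ StrictMono σ ∧
      Tendsto (fun k => eLpNorm (fun x => φ (σ k) x - u x) 2 (volume.restrict Ω)) atTop (𝓝 0) ∧
      ∫ x in Ω, ‖g x‖ ^ 2 ≤ τ := by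
  obtain ⟨D, hD⟩ := hτ.bddAbove_range
  replace hD : ∀ k, ∫ x in Ω, ‖∇ (φ k) x‖ ^ 2 ≤ D := fun k => hD ⟨k, rfl⟩
  have n1 : ∀ k, ‖(hφ k).memLp.toLp (φ k)‖ ^ 2 = ∫ x in Ω, |φ k x| ^ 2 :=
    fun k => MemLp.norm_toLp_sq _
  have n2 : ∀ k, ‖(hφ k).memLp_gradient.toLp (∇ (φ k))‖ ^ 2 = ∫ x in Ω, ‖∇ (φ k) x‖ ^ 2 :=
    fun k => MemLp.norm_toLp_sq _
  have hsep := separableSpace_pairSpace Ω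
  obtain ⟨h, σ, hσ, hlim⟩ := exists_weak_limit (x := fun k => (hφ k).toPair) (C := √(C + D))
    fun k => by
      refine Real.le_sqrt_of_sq_le ?_
      rw [WithLp.prod_norm_sq_eq_of_L2]
      exact add_le_add ((n1 k).trans_le (hC k)) ((n2 k).trans_le (hD k))
  -- A weak limit of test pairs is orthogonal to everything orthogonal to them, hence lies in the
  -- closed span.
  have hclos : h ∈ (testPairs Ω).topologicalClosure := by
    rw [← Submodule.orthogonal_orthogonal_eq_closure, Submodule.mem_orthogonal']
    intro y hy
    refine tendsto_nhds_unique (hlim y) (tendsto_const_nhds.congr fun k => ?_)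
    exact ((Submodule.mem_orthogonal _ _).1 hy _ ⟨_, hφ _, rfl⟩).symm
  have hτσ := hτ.comp hσ.tendsto_atTop
  -- strong convergence
  have hcauchy : CauchySeq fun k => (hφ (σ k)).memLp.toLp (φ (σ k)) := by
    have hR := tendsto_integral_sub_sq hfin (fun k => hφ (σ k)) (C := max C D)
      (fun k => (hC _).trans (le_max_left _ _)) (fun k => (hD _).trans (le_max_right _ _))
      fun y hy => ⟨inner ℝ h (WithLp.toLp 2 (hy.toLp y, 0)), ?_⟩
    rotate_left
    · refine (hlim (WithLp.toLp 2 (hy.toLp y, 0))).congr fun k => ?_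
      simp only [IsTestFunction.toPair, WithLp.prod_inner_apply, inner_zero_right, add_zero]
      rw [L2.inner_def]
      refine integral_congr_ae ?_
      filter_upwards [hy.coeFn_toLp, (hφ (σ k)).memLp.coeFn_toLp] with x h1 h2
      simp [h1, h2, mul_comm]
    · rw [cauchySeq_iff_tendsto_dist_atTop_0]
      have h2 := (Real.continuous_sqrt.tendsto 0).comp hR
      rw [Real.sqrt_zero] at h2
      refine h2.congr fun p => ?_
      have : dist ((hφ (σ p.1)).memLp.toLp (φ (σ p.1))) ((hφ (σ p.2)).memLp.toLp (φ (σ p.2))) ^ 2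
          = ∫ x in Ω, |φ (σ p.1) x - φ (σ p.2) x| ^ 2 := by
        rw [dist_eq_norm, ← MemLp.toLp_sub, MemLp.norm_toLp_sq]
        rfl
      simp only [Function.comp_apply]
      rw [← this, Real.sqrt_sq dist_nonneg]
  obtain ⟨u', hu'⟩ := cauchySeq_tendsto_of_complete hcauchy
  -- Pairing with `(y, 0)` identifies the strong limit with the first component of the weak limit.
  have hu : u' = h.fst := by
    refine ext_inner_right ℝ fun y => ?_
    have t1 : Tendsto (fun k => inner ℝ ((hφ (σ k)).memLp.toLp (φ (σ k))) y) atTop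
        (𝓝 (inner ℝ u' y)) := hu'.inner tendsto_const_nhds
    have t2 := hlim (WithLp.toLp 2 (y, 0))
    simp only [IsTestFunction.toPair, WithLp.prod_inner_apply, inner_zero_right, add_zero] at t2
    exact tendsto_nhds_unique t1 t2
  subst hu
  refine ⟨h.fst, h.snd, σ, hasTestApprox_of_mem_closure hclos, hσ, ?_, ?_⟩
  · exact (Lp.tendsto_Lp_iff_tendsto_eLpNorm'' (fun k => φ (σ k)) (fun k => (hφ (σ k)).memLp) _
      (Lp.memLp _)).1 (by simpa using hu')
  -- lower semicontinuity
  rw [← Lp_norm_sq]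
  -- Pairing with the limit gradient itself yields `‖g‖² ≤ √τ ‖g‖`.
  have t2 := hlim (WithLp.toLp 2 (0, h.snd))
  simp only [IsTestFunction.toPair, WithLp.prod_inner_apply, inner_zero_right, zero_add] at t2
  have t3 : Tendsto (fun k => √(∫ x in Ω, ‖∇ (φ (σ k)) x‖ ^ 2) * ‖h.snd‖) atTop
      (𝓝 (√τ * ‖h.snd‖)) := (hτσ.sqrt).mul_const _
  have hle : ‖h.snd‖ ^ 2 ≤ √τ * ‖h.snd‖ := by
    rw [← real_inner_self_eq_norm_sq]
    refine le_of_tendsto_of_tendsto' t2 t3 fun k => ?_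
    refine (real_inner_le_norm _ _).trans (le_of_eq ?_)
    rw [← n2, Real.sqrt_sq (norm_nonneg _)]
  have hτ0 : 0 ≤ τ := ge_of_tendsto' hτ fun k => integral_nonneg fun x => by positivity
  have hn : ‖h.snd‖ ≤ √τ := by
    by_contra! hlt
    nlinarith [Real.sqrt_nonneg τ]
  calc ‖h.snd‖ ^ 2 ≤ √τ ^ 2 := by gcongr
    _ = τ := Real.sq_sqrt hτ0

/-! ### Reduction of the variational problems to test functions -/

section Variational

variable {Ω : Set (E n)}

theorem integral_abs_sq_pos {u : E n → ℝ} (hu : MemLp u 2 (volume.restrict Ω))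
    (h0 : ¬ u =ᵐ[volume.restrict Ω] 0) : 0 < ∫ x in Ω, |u x| ^ 2 := by
  refine lt_of_le_of_ne (integral_nonneg fun x => by positivity) fun h => h0 ?_
  have := (integral_eq_zero_iff_of_nonneg (fun x => by positivity) (integrable_abs_sq hu)).1 h.symm
  filter_upwards [this] with x hx
  simpa using hx

theorem integral_abs_sq_pos_of_mem {v : E n → ℝ} (hv : v ∈ admissible Ω) :
    0 < ∫ x in Ω, |v x| ^ 2 :=
  integral_abs_sq_pos hv.1.memLp hv.2

theorem HasTestApprox.mem_admissible (hΩ : IsOpen Ω) {u : E n → ℝ} {g : E n → E n}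
    (h : HasTestApprox Ω u g) (hpos : 0 < ∫ x in Ω, |u x| ^ 2) : u ∈ admissible Ω := by
  refine ⟨h.memW12Zero hΩ, fun h0 => hpos.ne' ?_⟩
  rw [← integral_zero (E n) ℝ]
  refine integral_congr_ae ?_
  filter_upwards [h0] with x hx
  simp [hx]

theorem rayleigh_nonneg (v : E n → ℝ) : 0 ≤ rayleigh Ω v :=
  div_nonneg (integral_nonneg fun x => by positivity) (integral_nonneg fun x => by positivity)

theorem bddBelow_rayleigh (S : Set (E n → ℝ)) : BddBelow (rayleigh Ω '' S) :=
  ⟨0, by rintro _ ⟨v, -, rfl⟩; exact rayleigh_nonneg v⟩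

/-- Normalized test functions that almost realize the quotient of a constrained function. -/
theorem exists_isTestFunction_near {v : E n → ℝ} (hv : v ∈ admissibleTwisted Ω) {ε : ℝ}
    (hε : 0 < ε) : ∃ φ, IsTestFunction Ω φ ∧ ∫ x in Ω, |φ x| ^ 2 = 1 ∧
      |∫ x in Ω, |φ x| * φ x| < ε ∧ |(∫ x in Ω, ‖∇ φ x‖ ^ 2) - rayleigh Ω v| < ε := by
  obtain ⟨φ, hφ, h1, h2, h3⟩ := hv.1.1.hasTestApprox.exists_tendsto_integral
  have hpos := integral_abs_sq_pos_of_mem hv.1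
  have t2 := h2.div h1 hpos.ne'
  have t3 := h3.div h1 hpos.ne'
  rw [hv.2, zero_div] at t2
  have e2 := Metric.tendsto_nhds.1 t2 ε hε
  have e3 := Metric.tendsto_nhds.1 t3 ε hε
  obtain ⟨k, hk1, hk2, hk3⟩ := ((h1.eventually (lt_mem_nhds hpos)).and (e2.and e3)).exists
  set s := ∫ x in Ω, |φ k x| ^ 2 with hs
  set c := (√s)⁻¹ with hc
  have hc0 : 0 ≤ c := by positivity
  have hc2 : c ^ 2 = s⁻¹ := by rw [hc, inv_pow, Real.sq_sqrt hk1.le]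
  refine ⟨_, (hφ k).const_mul c, ?_, ?_, ?_⟩
  · simp only [abs_mul, mul_pow, abs_of_nonneg hc0]
    rw [integral_const_mul, ← hs, hc2, inv_mul_cancel₀ hk1.ne']
  · have : ∀ x, |c * φ k x| * (c * φ k x) = c ^ 2 * (|φ k x| * φ k x) := by
      intro x; rw [abs_mul, abs_of_nonneg hc0]; ring
    simp only [this]
    rw [integral_const_mul, hc2, inv_mul_eq_div]
    simpa only [Pi.div_apply, Real.dist_eq, sub_zero] using hk2
  · simp only [(hφ k).gradient_const_mul c, norm_smul, mul_pow, Real.norm_eq_abs,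
      abs_of_nonneg hc0]
    rw [integral_const_mul, hc2, inv_mul_eq_div]
    simpa only [Pi.div_apply, Real.dist_eq, rayleigh] using hk3

/-- The minimum `λ_T(Ω)` is attained. -/
theorem exists_isLambdaTMinimizer (hΩ : IsOpen Ω) (hfin : volume Ω ≠ ⊤)
    (hne : (admissibleTwisted Ω).Nonempty) : ∃ u, IsLambdaTMinimizer Ω u := by
  have hseq : ∀ k : ℕ, ∃ v ∈ admissibleTwisted Ω,
      rayleigh Ω v < lambdaT Ω + 1 / ((k : ℝ) + 1) := by
    intro k
    obtain ⟨_, ⟨v, hv, rfl⟩, h⟩ := exists_lt_of_csInf_lt (hne.image _)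
      (lt_add_of_pos_right (lambdaT Ω) (Nat.one_div_pos_of_nat (α := ℝ) (n := k)))
    exact ⟨v, hv, h⟩
  choose v hv hvlt using hseq
  have hge : ∀ w ∈ admissibleTwisted Ω, lambdaT Ω ≤ rayleigh Ω w := fun w hw =>
    csInf_le (bddBelow_rayleigh _) ⟨w, hw, rfl⟩
  -- The test functions satisfy the constraint only up to `1 / (k + 1)`; it becomes exact in the
  -- limit.
  choose φ hφ h1 h2 h3 using fun k : ℕ =>
    exists_isTestFunction_near (hv k) (Nat.one_div_pos_of_nat (α := ℝ) (n := k))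
  have hz := tendsto_one_div_add_atTop_nhds_zero_nat (𝕜 := ℝ)
  have hτ : Tendsto (fun k => ∫ x in Ω, ‖∇ (φ k) x‖ ^ 2) atTop (𝓝 (lambdaT Ω)) := by
    -- One error `1 / (k + 1)` comes from `v k` being almost minimal, the other from its
    -- approximation by `φ k`.
    have hup : Tendsto (fun k : ℕ => lambdaT Ω + 2 * (1 / ((k : ℝ) + 1))) atTop
        (𝓝 (lambdaT Ω)) := by simpa using (hz.const_mul 2).const_add (lambdaT Ω)
    have hlo : Tendsto (fun k : ℕ => lambdaT Ω - 1 / ((k : ℝ) + 1)) atTop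
        (𝓝 (lambdaT Ω)) := by simpa using hz.const_sub (lambdaT Ω)
    refine tendsto_of_tendsto_of_tendsto_of_le_of_le hlo hup (fun k => ?_) fun k => ?_
    · have := abs_lt.1 (h3 k)
      have := hge _ (hv k)
      simp only
      linarith
    · have := abs_lt.1 (h3 k)
      have := hvlt k
      simp only
      linarith
  obtain ⟨u, g, σ, hu, hσ, hlim, hle⟩ :=
    exists_limit_of_bounded hfin hφ (fun k => (h1 k).le) hτ
  have l1 : ∫ x in Ω, |u x| ^ 2 = 1 := by
    refine tendsto_nhds_unique (tendsto_integral_of_quadratic (N := fun y : ℝ => |y| ^ 2)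
      (by fun_prop) (by simp) (fun y z => norm_sq_sub_norm_sq_le y z)
      (fun k => (hφ (σ k)).memLp) hu.memLp hlim) ?_
    simp only [h1]
    exact tendsto_const_nhds
  have l2 : ∫ x in Ω, |u x| * u x = 0 := by
    refine tendsto_nhds_unique (tendsto_integral_of_quadratic (N := fun y : ℝ => |y| * y)
      (by fun_prop) (by simp) abs_mul_self_sub_abs_mul_self_le
      (fun k => (hφ (σ k)).memLp) hu.memLp hlim) ?_
    exact squeeze_zero_norm (fun k => (h2 (σ k)).le) (hz.comp hσ.tendsto_atTop)
  refine ⟨u, ⟨hu.mem_admissible hΩ (by rw [l1]; exact one_pos), l2⟩, fun w hw => ?_⟩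
  refine le_trans ?_ (hge w hw)
  rw [rayleigh, hu.integral_norm_weakGradient hΩ, l1, div_one]
  exact hle

end Variational

/-! ### Radial vector fields and Picone's inequality -/

theorem gradient_apply (φ : E n → ℝ) (x : E n) (i : Fin n) :
    (∇ φ x) i = fderiv ℝ φ x (EuclideanSpace.single i 1) := by
  have := inner_gradient_left (f := φ) (x := x) (y := EuclideanSpace.single i (1 : ℝ))
  rw [EuclideanSpace.inner_single_right] at this
  simpa using this

theorem sum_coord_sq (x y : E n) : ∑ i, (x i - y i) ^ 2 = ‖x - y‖ ^ 2 := by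
  simp [EuclideanSpace.norm_sq_eq]

theorem hasFDerivAt_norm_sub_sq (x x₀ : E n) :
    HasFDerivAt (fun y : E n => ‖y - x₀‖ ^ 2) (2 • innerSL ℝ (x - x₀)) x := by
  simpa using! ((hasFDerivAt_id x).sub_const x₀).norm_sq

theorem fderiv_radial {κ : ℝ → ℝ} {κ' : ℝ} {x x₀ : E n} (h : HasDerivAt κ κ' (‖x - x₀‖ ^ 2))
    (i : Fin n) :
    fderiv ℝ (fun y : E n => κ (‖y - x₀‖ ^ 2) * (y i - x₀ i)) x (EuclideanSpace.single i 1) =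
      κ (‖x - x₀‖ ^ 2) + 2 * κ' * (x i - x₀ i) ^ 2 := by
  have h1 := h.comp_hasFDerivAt x (hasFDerivAt_norm_sub_sq x x₀)
  have h2 : HasFDerivAt (fun y : E n => y i - x₀ i) (EuclideanSpace.proj i : E n →L[ℝ] ℝ) x :=
    ((EuclideanSpace.proj i : E n →L[ℝ] ℝ).hasFDerivAt).sub_const _
  have h3 := (h1.mul h2).fderiv
  simp only [Function.comp_apply] at h3
  have h4 : (fun y : E n => κ (‖y - x₀‖ ^ 2) * (y i - x₀ i)) =
      (κ ∘ fun y : E n => ‖y - x₀‖ ^ 2) * fun y => y i - x₀ i := rfl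
  rw [h4, h3]
  simp [EuclideanSpace.inner_single_right]
  ring

/-- The divergence of a radial vector field. -/
theorem sum_fderiv_radial {κ : ℝ → ℝ} {κ' : ℝ} {x x₀ : E n}
    (h : HasDerivAt κ κ' (‖x - x₀‖ ^ 2)) :
    ∑ i, fderiv ℝ (fun y : E n => κ (‖y - x₀‖ ^ 2) * (y i - x₀ i)) x
        (EuclideanSpace.single i 1) =
      n * κ (‖x - x₀‖ ^ 2) + 2 * κ' * ‖x - x₀‖ ^ 2 := by
  simp only [fderiv_radial h]
  rw [Finset.sum_add_distrib, ← Finset.mul_sum, sum_coord_sq]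
  simp

/-- The divergence theorem for `f F` where `f` is smooth with compact support and `F` is of
class `C¹` near the support of `f`. -/
theorem integral_divergence_eq_zero {f : E n → ℝ} {F : Fin n → E n → ℝ} (hf : ContDiff ℝ 1 f)
    (hc : HasCompactSupport f) (hF : ∀ x ∈ tsupport f, ∀ i, ContDiffAt ℝ 1 (F i) x) :
    Integrable (fun x => ∑ i, (f x * fderiv ℝ (F i) x (EuclideanSpace.single i 1) +
        (∇ f x) i * F i x)) ∧
      ∫ x, ∑ i, (f x * fderiv ℝ (F i) x (EuclideanSpace.single i 1) + (∇ f x) i * F i x) = 0 := by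
  have hG : ∀ i, ContDiff ℝ 1 fun x => f x * F i x := by
    intro i
    refine contDiff_iff_contDiffAt.2 fun x => ?_
    by_cases hx : x ∈ tsupport f
    · exact hf.contDiffAt.mul (hF x hx i)
    · have h0 : (fun x => f x * F i x) =ᶠ[𝓝 x] fun _ => 0 := by
        filter_upwards [notMem_tsupport_iff_eventuallyEq.1 hx] with y hy
        simp [hy]
      exact contDiffAt_const.congr_of_eventuallyEq h0
  have hGc : ∀ i, HasCompactSupport fun x => f x * F i x := fun i => hc.mul_right
  have e : ∀ x i, f x * fderiv ℝ (F i) x (EuclideanSpace.single i 1) + (∇ f x) i * F i x =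
      fderiv ℝ (fun x => f x * F i x) x (EuclideanSpace.single i 1) := by
    intro x i
    by_cases hx : x ∈ tsupport f
    · rw [fderiv_fun_mul (hf.differentiable one_ne_zero x)
        ((hF x hx i).differentiableAt one_ne_zero), gradient_apply]
      simp [mul_comm]
    · have h0 : (fun x => f x * F i x) =ᶠ[𝓝 x] fun _ => 0 := by
        filter_upwards [notMem_tsupport_iff_eventuallyEq.1 hx] with y hy
        simp [hy]
      rw [h0.fderiv_eq, IsTestFunction.gradient_eq_zero_of_notMem_tsupport hx,
        image_eq_zero_of_notMem_tsupport hx]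
      simp
  simp only [e]
  have hi : ∀ i, Integrable fun x =>
      fderiv ℝ (fun x => f x * F i x) x (EuclideanSpace.single i 1) := fun i =>
    (((hG i).continuous_fderiv one_ne_zero).clm_apply
      continuous_const).integrable_of_hasCompactSupport ((hGc i).fderiv_apply ℝ _)
  refine ⟨integrable_finsetSum _ fun i _ => hi i, ?_⟩
  rw [integral_finsetSum _ fun i _ => hi i]
  exact Finset.sum_eq_zero fun i _ => integral_fderiv_eq_zero (hG i) (hGc i) _

/-- **Picone's inequality**, for a vector field `F` (the logarithmic gradient of a positive
solution) with `div F + |F|² ≤ -l`. -/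
theorem IsTestFunction.picone {Ω : Set (E n)} {φ : E n → ℝ} (hφ : IsTestFunction Ω φ) {l : ℝ}
    {F : Fin n → E n → ℝ} (hF : ∀ x ∈ Ω, ∀ i, ContDiffAt ℝ 1 (F i) x)
    (hdiv : ∀ x ∈ Ω, ∑ i, fderiv ℝ (F i) x (EuclideanSpace.single i 1) + ∑ i, F i x ^ 2 ≤ -l) :
    l * ∫ x in Ω, |φ x| ^ 2 ≤ ∫ x in Ω, ‖∇ φ x‖ ^ 2 := by
  have hsq : ContDiff ℝ 1 fun x => φ x ^ 2 := hφ.contDiff_one.pow 2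
  have hsupp : tsupport (fun x => φ x ^ 2) ⊆ tsupport φ :=
    closure_mono fun x hx h0 => hx (by simp [h0])
  have hc : HasCompactSupport fun x => φ x ^ 2 :=
    hφ.hasCompactSupport.of_isClosed_subset (isClosed_tsupport _) hsupp
  -- The field `φ² F` has integral divergence zero; adding it to `l φ²` reduces the claim to the
  -- pointwise inequality `|∇φ - φ F|² ≥ 0`.
  obtain ⟨hi, h0⟩ := integral_divergence_eq_zero hsq hc
    fun x hx i => hF x (hφ.tsupport_subset (hsupp hx)) i
  have hgr : ∀ x i, (∇ (fun y => φ y ^ 2) x) i = 2 * φ x * (∇ φ x) i := by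
    intro x i
    rw [gradient_apply, gradient_apply, fderiv_fun_pow 2 (hφ.differentiable x)]
    simp
  rw [setIntegral_eq_integral_of_forall_compl_eq_zero (fun x hx => by simp [hφ.apply_eq_zero hx]),
    setIntegral_eq_integral_of_forall_compl_eq_zero
      (fun x hx => by simp [hφ.gradient_eq_zero hx]), ← integral_const_mul]
  have i1 : Integrable fun x => ‖∇ φ x‖ ^ 2 :=
    (hφ.continuous_gradient.norm.pow 2).integrable_of_hasCompactSupport
      (HasCompactSupport.intro hφ.hasCompactSupport fun x hx => by
        simp [gradient_eq_zero_of_notMem_tsupport hx])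
  have i2 : Integrable fun x => l * |φ x| ^ 2 :=
    (continuous_const.mul (hφ.contDiff.continuous.abs.pow 2)).integrable_of_hasCompactSupport
      (HasCompactSupport.intro hφ.hasCompactSupport fun x hx => by
        simp [image_eq_zero_of_notMem_tsupport hx])
  suffices h : ∫ x, (l * |φ x| ^ 2 + ∑ i, (φ x ^ 2 *
      fderiv ℝ (F i) x (EuclideanSpace.single i 1) + (∇ (fun y => φ y ^ 2) x) i * F i x)) ≤
      ∫ x, ‖∇ φ x‖ ^ 2 by
    rwa [integral_add i2 hi, h0, add_zero] at h
  refine integral_mono (i2.add hi) i1 fun x => ?_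
  simp only [hgr]
  by_cases hx : x ∈ Ω
  · have h1 := mul_le_mul_of_nonneg_left (hdiv x hx) (sq_nonneg (φ x))
    have h2 : 0 ≤ ∑ i, ((∇ φ x) i - φ x * F i x) ^ 2 := Finset.sum_nonneg fun i _ => sq_nonneg _
    have h3 : ∑ i, ((∇ φ x) i - φ x * F i x) ^ 2 = ‖∇ φ x‖ ^ 2 -
        ∑ i, 2 * φ x * (∇ φ x) i * F i x + φ x ^ 2 * ∑ i, F i x ^ 2 := by
      rw [EuclideanSpace.norm_sq_eq, Finset.mul_sum, ← Finset.sum_sub_distrib,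
        ← Finset.sum_add_distrib]
      refine Finset.sum_congr rfl fun i _ => ?_
      rw [Real.norm_eq_abs, sq_abs]
      ring
    rw [Finset.sum_add_distrib, ← Finset.mul_sum, sq_abs]
    linarith
  · simp [hφ.apply_eq_zero hx]

/-! ### Positive radial solutions of `-Δ w = l w` -/

theorem hasDerivAt_besselSeries_scaled {ν : ℝ} (hν : 0 ≤ ν) (l s : ℝ) :
    HasDerivAt (fun s => besselSeries ν (l / 4 * s)) (-(l / 4 * besselSeries (ν + 1) (l / 4 * s)))
      s := by
  have h2 : HasDerivAt (fun s : ℝ => l / 4 * s) (l / 4) s := by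
    simpa using (hasDerivAt_id s).const_mul (l / 4)
  refine ((hasDerivAt_besselSeries hν (l / 4 * s)).comp s h2).congr_deriv ?_
  ring

/-- If `x ↦ H_ν(l |x - c|² / 4)`, `ν = n / 2 - 1`, is positive in `Ω`, where `c` is locally
constant in `Ω`, then the first Dirichlet eigenvalue of `Ω` is at least `l`. -/
theorem IsTestFunction.le_of_besselSeries_pos {Ω : Set (E n)} {φ : E n → ℝ}
    (hφ : IsTestFunction Ω φ) {ν : ℝ} (hν : 0 ≤ ν) (hνn : ν = n / 2 - 1) {l : ℝ} {c : E n → E n}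
    (hc : ∀ x ∈ Ω, ∀ᶠ y in 𝓝 x, c y = c x)
    (hpos : ∀ x ∈ Ω, 0 < besselSeries ν (l / 4 * ‖x - c x‖ ^ 2)) :
    l * ∫ x in Ω, |φ x| ^ 2 ≤ ∫ x in Ω, ‖∇ φ x‖ ^ 2 := by
  -- For `w(y) = H_ν(l|y - c|²/4)` one has `∇w / w = ψ(|y - c|²) (y - c)`, since `H_ν' = -H_{ν+1}`.
  set ψ : ℝ → ℝ := fun s => -(l / 2) * besselSeries (ν + 1) (l / 4 * s) /
    besselSeries ν (l / 4 * s) with hψ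
  have hs0 := contDiff_besselSeries hν
  have hs1 := contDiff_besselSeries (by linarith : 0 ≤ ν + 1)
  have hlin : ContDiff ℝ ∞ fun s : ℝ => l / 4 * s := contDiff_const.mul contDiff_id
  have hloc : ∀ x ∈ Ω, ∀ i, (fun y : E n => ψ (‖y - c y‖ ^ 2) * (y i - c y i)) =ᶠ[𝓝 x]
      fun y => ψ (‖y - c x‖ ^ 2) * (y i - c x i) := by
    intro x hx i
    filter_upwards [hc x hx] with y hy
    rw [hy]
  refine hφ.picone (F := fun i y => ψ (‖y - c y‖ ^ 2) * (y i - c y i)) (fun x hx i => ?_)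
    fun x hx => ?_
  · refine ContDiffAt.congr_of_eventuallyEq ?_ (hloc x hx i)
    have hψs : ContDiffAt ℝ 1 ψ (‖x - c x‖ ^ 2) := by
      have : ContDiffAt ℝ ∞ ψ (‖x - c x‖ ^ 2) :=
        ((contDiff_const.mul (hs1.comp hlin)).contDiffAt).div ((hs0.comp hlin).contDiffAt)
          (hpos x hx).ne'
      exact this.of_le (by exact_mod_cast le_top)
    have hn : ContDiff ℝ 1 fun y : E n => ‖y - c x‖ ^ 2 :=
      (contDiff_id.sub contDiff_const).norm_sq ℝ
    refine (hψs.comp x hn.contDiffAt).mul (ContDiff.contDiffAt ?_)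
    exact (EuclideanSpace.proj i : E n →L[ℝ] ℝ).contDiff.sub contDiff_const
  · set s := ‖x - c x‖ ^ 2 with hs
    set H0 := besselSeries ν (l / 4 * s) with hH0
    set H1 := besselSeries (ν + 1) (l / 4 * s) with hH1
    set H2 := besselSeries (ν + 2) (l / 4 * s) with hH2
    have hp : 0 < H0 := hpos x hx
    have hd : HasDerivAt ψ ((-(l / 2) * -(l / 4 * H2) * H0 -
        -(l / 2) * H1 * -(l / 4 * H1)) / H0 ^ 2) s := by
      have d1 := (hasDerivAt_besselSeries_scaled (by linarith : 0 ≤ ν + 1) l s).const_mul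
        (-(l / 2))
      rw [show ν + 1 + 1 = ν + 2 by ring] at d1
      exact d1.div (hasDerivAt_besselSeries_scaled hν l s) hp.ne'
    have e1 : ∀ i, fderiv ℝ (fun y : E n => ψ (‖y - c y‖ ^ 2) * (y i - c y i)) x =
        fderiv ℝ (fun y : E n => ψ (‖y - c x‖ ^ 2) * (y i - c x i)) x :=
      fun i => (hloc x hx i).fderiv_eq
    simp only [e1]
    rw [sum_fderiv_radial hd]
    simp only [mul_pow]
    rw [← Finset.mul_sum, sum_coord_sq, ← hs]
    have hrec := besselSeries_recurrence hν (l / 4 * s)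
    rw [← hH0, ← hH1, ← hH2, hνn] at hrec
    -- As `ν + 1 = n/2`, the recurrence is exactly `div F + |F|² = -l`.
    refine le_of_eq ?_
    simp only [hψ, ← hH0, ← hH1]
    field_simp
    linear_combination (16 * l * H0) * hrec

/-! ### Existence of the first zero, and eigenfunctions of balls -/

theorem exists_isTestFunction_pos (x₀ : E n) {R : ℝ} (hR : 0 < R) :
    ∃ φ, IsTestFunction (Metric.ball x₀ R) φ ∧ 0 < ∫ x in Metric.ball x₀ R, |φ x| ^ 2 := by
  let f : ContDiffBump x₀ := ⟨R / 4, R / 2, by positivity, by linarith⟩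
  have hf : IsTestFunction (Metric.ball x₀ R) f := by
    refine ⟨f.contDiff, f.hasCompactSupport, ?_⟩
    rw [f.tsupport_eq]
    exact Metric.closedBall_subset_ball (half_lt_self hR)
  refine ⟨f, hf, integral_abs_sq_pos hf.memLp fun h => ?_⟩
  have h1 : Metric.ball x₀ (R / 4) ⊆ Metric.ball x₀ R := Metric.ball_subset_ball (by linarith)
  have h2 : ∀ᵐ x ∂volume.restrict (Metric.ball x₀ (R / 4)), False := by
    filter_upwards [ae_restrict_of_ae_restrict_of_subset h1 h,
      ae_restrict_mem measurableSet_ball] with x hx hx'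
    rw [f.one_of_mem_closedBall (Metric.ball_subset_closedBall hx')] at hx
    exact one_ne_zero hx
  rw [eventually_false_iff_eq_bot, ae_eq_bot, Measure.restrict_eq_zero] at h2
  exact (Metric.measure_ball_pos volume x₀ (by positivity : 0 < R / 4)).ne' h2

/-- The Bessel function `J_{n/2-1}` has a positive zero: otherwise the Dirichlet integral in a ball
would be bounded below by arbitrarily large multiples of the `L²` norm. -/
theorem besselZeros_nonempty {ν : ℝ} (hν : 0 ≤ ν) (hνn : ν = n / 2 - 1) :
    (besselZeros ν).Nonempty := by
  by_contra hempty
  have hpos : ∀ t, 0 ≤ t → 0 < besselSeries ν t := fun t ht =>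
    besselSeries_pos_of_ne_zero hν
      (fun s hs _ h0 => hempty ⟨_, two_mul_sqrt_mem_besselZeros hs h0⟩) ht (lt_add_one t)
  obtain ⟨φ, hφ, hA⟩ := exists_isTestFunction_pos (0 : E n) one_pos
  set A := ∫ x in Metric.ball (0 : E n) 1, |φ x| ^ 2
  set D := ∫ x in Metric.ball (0 : E n) 1, ‖∇ φ x‖ ^ 2
  have hD : 0 ≤ D := integral_nonneg fun x => by positivity
  -- The value `D / A + 1` exceeds the Dirichlet quotient of `φ`, which contradicts the lower bound.
  have h := hφ.le_of_besselSeries_pos hν hνn (l := D / A + 1) (c := fun _ => 0)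
    (fun _ _ => Eventually.of_forall fun _ => rfl) fun x _ => hpos _ (by positivity)
  change (D / A + 1) * A ≤ D at h
  rw [add_mul, div_mul_cancel₀ _ hA.ne'] at h
  linarith

/-- The first Dirichlet eigenfunction of a ball, normalized and extended by zero. -/
theorem exists_ball_eigenfunction {ν j : ℝ} (hν : 0 ≤ ν) (hνn : ν = n / 2 - 1)
    (hj : IsLeast (besselZeros ν) j) (x₀ : E n) {R : ℝ} (hR : 0 < R) :
    ∃ (u : E n → ℝ) (g : E n → E n), HasTestApprox (Metric.ball x₀ R) u g ∧ (∀ x, 0 ≤ u x) ∧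
      (∀ x ∉ Metric.ball x₀ R, u x = 0) ∧ (∀ x ∉ Metric.ball x₀ R, g x = 0) ∧
      ∫ x in Metric.ball x₀ R, |u x| ^ 2 = 1 ∧
      ∫ x in Metric.ball x₀ R, ‖g x‖ ^ 2 = j ^ 2 / R ^ 2 := by
  set B := Metric.ball x₀ R with hB
  set l := j ^ 2 / R ^ 2 with hl
  have hj0 : 0 < j := hj.1.1
  have hl0 : 0 < l := by positivity
  obtain ⟨hzero, hposJ⟩ := besselSeries_firstBesselZero hν hj
  have hlR : l / 4 * R ^ 2 = j ^ 2 / 4 := by rw [hl]; field_simp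
  set w : E n → ℝ := fun x => besselSeries ν (l / 4 * ‖x - x₀‖ ^ 2) with hw
  have hwsm : ContDiff ℝ ∞ w := (contDiff_besselSeries hν).comp
    (contDiff_const.mul ((contDiff_id.sub contDiff_const).norm_sq ℝ))
  have hwpos : ∀ x ∈ B, 0 < w x := by
    intro x hx
    refine hposJ _ (by positivity) ?_
    rw [← hlR]
    have : ‖x - x₀‖ < R := by simpa [hB, dist_eq_norm] using hx
    gcongr
  -- On the sphere the argument of `H_ν` is `j²/4`, its first zero.
  have hwfr : ∀ x ∈ frontier B, w x ≤ 0 := by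
    intro x hx
    rw [hB, frontier_ball _ hR.ne', mem_sphere_iff_norm] at hx
    simp only [hw, hx, hlR, hzero, le_refl]
  have hP := hasTestApprox_indicator_posPart Metric.isOpen_ball Metric.isBounded_ball
    (Subset.refl B) hwsm hwfr
  set u : E n → ℝ := B.indicator fun x => max (w x) 0 with hu
  set g : E n → E n := (B ∩ {x | 0 < w x}).indicator (∇ w) with hg
  have hux : ∀ x ∈ B, u x = w x := fun x hx => by
    rw [hu, indicator_of_mem hx, max_eq_left (hwpos x hx).le]
  have hgx : ∀ x ∈ B, g x = ∇ w x := fun x hx => by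
    have : x ∈ B ∩ {x | 0 < w x} := ⟨hx, hwpos x hx⟩
    rw [hg, indicator_of_mem this]
  have hu0 : ∀ x, 0 ≤ u x := fun x => indicator_nonneg (fun y _ => le_max_right _ _) x
  have hun : ∀ x ∉ B, u x = 0 := fun x hx => indicator_of_notMem hx _
  have hgn : ∀ x ∉ B, g x = 0 := fun x hx => indicator_of_notMem (fun h => hx h.1) _
  -- the equation
  set κ : ℝ → ℝ := fun s => -(l / 2) * besselSeries (ν + 1) (l / 4 * s) with hκ
  have hν1 : 0 ≤ ν + 1 := by linarith
  have hκd : ∀ s, HasDerivAt κ (-(l / 2) * -(l / 4 * besselSeries (ν + 2) (l / 4 * s))) s := by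
    intro s
    have d1 := (hasDerivAt_besselSeries_scaled hν1 l s).const_mul (-(l / 2))
    rwa [show ν + 1 + 1 = ν + 2 by ring] at d1
  have hgrad : ∀ x i, (∇ w x) i = κ (‖x - x₀‖ ^ 2) * (x i - x₀ i) := by
    intro x i
    have h1 := (hasDerivAt_besselSeries_scaled hν l (‖x - x₀‖ ^ 2)).comp_hasFDerivAt x
      (hasFDerivAt_norm_sub_sq x x₀)
    change HasFDerivAt w _ x at h1
    rw [gradient_apply, h1.fderiv]
    simp [EuclideanSpace.inner_single_right, hκ]
    ring
  have hdiv : ∀ x, ∑ i, fderiv ℝ (fun y : E n => κ (‖y - x₀‖ ^ 2) * (y i - x₀ i)) x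
      (EuclideanSpace.single i 1) = -l * w x := by
    intro x
    rw [sum_fderiv_radial (hκd _)]
    have hrec := besselSeries_recurrence hν (l / 4 * ‖x - x₀‖ ^ 2)
    rw [show ν + 1 = (n : ℝ) / 2 by rw [hνn]; ring] at hrec
    simp only [hκ, hw]
    rw [show ν + 1 = (n : ℝ) / 2 by rw [hνn]; ring]
    linear_combination l * hrec
  have hFs : ∀ i, ContDiff ℝ 1 fun y : E n => κ (‖y - x₀‖ ^ 2) * (y i - x₀ i) := by
    intro i
    have h1 : ContDiff ℝ ∞ κ :=
      contDiff_const.mul ((contDiff_besselSeries hν1).comp (contDiff_const.mul contDiff_id))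
    have h2 : ContDiff ℝ ∞ fun y : E n => κ (‖y - x₀‖ ^ 2) * (y i - x₀ i) :=
      (h1.comp ((contDiff_id.sub contDiff_const).norm_sq ℝ)).mul
        ((EuclideanSpace.proj i : E n →L[ℝ] ℝ).contDiff.sub contDiff_const)
    exact h2.of_le (by exact_mod_cast le_top)
  -- The divergence theorem for `φ ∇w`, with `Δw = -l w`.
  have hweak : ∀ φ, IsTestFunction B φ →
      ∫ x in B, inner ℝ (∇ φ x) (g x) = l * ∫ x in B, φ x • u x := by
    intro φ hφ
    obtain ⟨hi, h0⟩ := integral_divergence_eq_zero hφ.contDiff_one hφ.hasCompactSupport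
      (F := fun i y => κ (‖y - x₀‖ ^ 2) * (y i - x₀ i)) fun x _ i => (hFs i).contDiffAt
    have e : ∀ x, ∑ i, (φ x * fderiv ℝ (fun y : E n => κ (‖y - x₀‖ ^ 2) * (y i - x₀ i)) x
        (EuclideanSpace.single i 1) + (∇ φ x) i * (κ (‖x - x₀‖ ^ 2) * (x i - x₀ i))) =
        inner ℝ (∇ φ x) (∇ w x) - l * (φ x * w x) := by
      intro x
      rw [Finset.sum_add_distrib, ← Finset.mul_sum, hdiv, PiLp.inner_apply]
      simp only [hgrad]
      simp only [RCLike.inner_apply, conj_trivial]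
      rw [Finset.sum_congr rfl fun i _ => mul_comm _ _]
      ring
    simp only [e] at h0
    have i1 : Integrable fun x => inner ℝ (∇ φ x) (∇ w x) :=
      (hφ.continuous_gradient.inner ((InnerProductSpace.toDual ℝ (E n)).symm.continuous.comp
        (hwsm.continuous_fderiv (by simp)))).integrable_of_hasCompactSupport
        (HasCompactSupport.intro hφ.hasCompactSupport fun x hx => by
          simp [IsTestFunction.gradient_eq_zero_of_notMem_tsupport hx])
    have i2 : Integrable fun x => l * (φ x * w x) :=
      (continuous_const.mul (hφ.contDiff.continuous.mul
        hwsm.continuous)).integrable_of_hasCompactSupport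
        (HasCompactSupport.intro hφ.hasCompactSupport fun x hx => by
          simp [image_eq_zero_of_notMem_tsupport hx])
    rw [integral_sub i1 i2, integral_const_mul, sub_eq_zero] at h0
    have e1 : ∫ x in B, inner ℝ (∇ φ x) (g x) = ∫ x in B, inner ℝ (∇ φ x) (∇ w x) :=
      setIntegral_congr_fun measurableSet_ball fun x hx => by simp only [hgx x hx]
    have e2 : ∫ x in B, φ x • u x = ∫ x in B, φ x * w x :=
      setIntegral_congr_fun measurableSet_ball fun x hx => by simp only [hux x hx, smul_eq_mul]
    rw [e1, e2, setIntegral_eq_integral_of_forall_compl_eq_zero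
        (fun x hx => by simp [hφ.gradient_eq_zero hx]),
      setIntegral_eq_integral_of_forall_compl_eq_zero
        (fun x hx => by simp [hφ.apply_eq_zero hx]), h0]
  -- Letting test functions tend to `u` in the weak equation gives the quotient without evaluating
  -- any Bessel integral.
  have hquot : ∫ x in B, ‖g x‖ ^ 2 = l * ∫ x in B, |u x| ^ 2 := by
    obtain ⟨φ, hφ, h1, h2⟩ := hP.exists_approx
    have t1 := tendsto_integral_inner_of_tendsto (fun k => (hφ k).memLp_gradient) hP.memLp_grad
      hP.memLp_grad h2
    have t2 := (tendsto_integral_smul_of_tendsto (fun k => (hφ k).memLp) hP.memLp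
      hP.memLp h1).const_mul l
    simp only [hweak _ (hφ _)] at t1
    have := tendsto_nhds_unique t1 t2
    simp only [real_inner_self_eq_norm_sq, smul_eq_mul] at this
    rw [this]
    congr 2
    funext x
    rw [sq_abs, sq]
  have hpos : 0 < ∫ x in B, |u x| ^ 2 := by
    refine integral_abs_sq_pos hP.memLp fun h => ?_
    have h2 : ∀ᵐ x ∂volume.restrict B, False := by
      filter_upwards [h, ae_restrict_mem measurableSet_ball] with x hx hx'
      rw [hux x hx'] at hx
      exact (hwpos x hx').ne' hx
    rw [eventually_false_iff_eq_bot, ae_eq_bot, Measure.restrict_eq_zero] at h2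
    exact (Metric.measure_ball_pos volume x₀ hR).ne' h2
  set s := ∫ x in B, |u x| ^ 2 with hs
  set c := (√s)⁻¹ with hc
  have hc0 : 0 ≤ c := by positivity
  have hc2 : c ^ 2 = s⁻¹ := by rw [hc, inv_pow, Real.sq_sqrt hpos.le]
  refine ⟨_, _, hP.const_mul c, fun x => mul_nonneg hc0 (hu0 x), fun x hx => by simp [hun x hx],
    fun x hx => by simp [hgn x hx], ?_, ?_⟩
  · simp only [abs_mul, mul_pow, abs_of_nonneg hc0]
    rw [integral_const_mul, ← hs, hc2, inv_mul_cancel₀ hpos.ne']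
  · simp only [norm_smul, mul_pow, Real.norm_eq_abs, abs_of_nonneg hc0]
    rw [integral_const_mul, hquot, hc2]
    field_simp

/-- For two disjoint balls of equal radii, the difference of the first eigenfunctions satisfies
the constraint. -/
theorem exists_twisted_eigenfunction {ν j : ℝ} (hν : 0 ≤ ν) (hνn : ν = n / 2 - 1)
    (hj : IsLeast (besselZeros ν) j) {x₁ x₂ : E n} {R : ℝ} (hR : 0 < R)
    (hdisj : Disjoint (Metric.ball x₁ R) (Metric.ball x₂ R)) {Ω : Set (E n)}
    (hΩ : MeasurableSet Ω) (h₁ : Metric.ball x₁ R ⊆ Ω) (h₂ : Metric.ball x₂ R ⊆ Ω) :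
    ∃ (v : E n → ℝ) (g : E n → E n), HasTestApprox Ω v g ∧ ∫ x in Ω, |v x| ^ 2 = 2 ∧
      ∫ x in Ω, |v x| * v x = 0 ∧ ∫ x in Ω, ‖g x‖ ^ 2 = 2 * (j ^ 2 / R ^ 2) := by
  obtain ⟨u₁, g₁, ha₁, hp₁, hu₁, hg₁, hn₁, hl₁⟩ := exists_ball_eigenfunction hν hνn hj x₁ hR
  obtain ⟨u₂, g₂, ha₂, hp₂, hu₂, hg₂, hn₂, hl₂⟩ := exists_ball_eigenfunction hν hνn hj x₂ hR
  have hm₁ := ha₁.mono measurableSet_ball h₁ hu₁ hg₁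
  have hm₂ := ha₂.mono measurableSet_ball h₂ hu₂ hg₂
  have i₁ := integrable_abs_sq hm₁.memLp
  have i₂ := integrable_abs_sq hm₂.memLp
  have k₁ := integrable_norm_sq hm₁.memLp_grad
  have k₂ := integrable_norm_sq hm₂.memLp_grad
  -- At each point one of the two functions vanishes with its gradient, so all cross terms drop out.
  have hcases : ∀ x, (u₂ x = 0 ∧ g₂ x = 0) ∨ (u₁ x = 0 ∧ g₁ x = 0) := by
    intro x
    by_cases hx : x ∈ Metric.ball x₁ R
    · have := disjoint_left.1 hdisj hx
      exact Or.inl ⟨hu₂ x this, hg₂ x this⟩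
    · exact Or.inr ⟨hu₁ x hx, hg₁ x hx⟩
  have e₁ : ∫ x in Ω, |u₁ x| ^ 2 = 1 := by
    rw [← hn₁]
    exact setIntegral_eq_of_subset_of_forall_sdiff_eq_zero hΩ h₁ fun x hx => by simp [hu₁ x hx.2]
  have e₂ : ∫ x in Ω, |u₂ x| ^ 2 = 1 := by
    rw [← hn₂]
    exact setIntegral_eq_of_subset_of_forall_sdiff_eq_zero hΩ h₂ fun x hx => by simp [hu₂ x hx.2]
  have f₁ : ∫ x in Ω, ‖g₁ x‖ ^ 2 = j ^ 2 / R ^ 2 := by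
    rw [← hl₁]
    exact setIntegral_eq_of_subset_of_forall_sdiff_eq_zero hΩ h₁ fun x hx => by simp [hg₁ x hx.2]
  have f₂ : ∫ x in Ω, ‖g₂ x‖ ^ 2 = j ^ 2 / R ^ 2 := by
    rw [← hl₂]
    exact setIntegral_eq_of_subset_of_forall_sdiff_eq_zero hΩ h₂ fun x hx => by simp [hg₂ x hx.2]
  refine ⟨_, _, hm₁.add (hm₂.const_mul (-1)), ?_, ?_, ?_⟩
  · have : ∀ x, |u₁ x + -1 * u₂ x| ^ 2 = |u₁ x| ^ 2 + |u₂ x| ^ 2 := fun x => by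
      rcases hcases x with ⟨h, -⟩ | ⟨h, -⟩ <;> simp [h]
    simp only [this]
    rw [integral_add i₁ i₂, e₁, e₂]
    norm_num
  · have : ∀ x, |u₁ x + -1 * u₂ x| * (u₁ x + -1 * u₂ x) = |u₁ x| ^ 2 - |u₂ x| ^ 2 := fun x => by
      rcases hcases x with ⟨h, -⟩ | ⟨h, -⟩
      · simp only [h, abs_of_nonneg (hp₁ x), mul_zero, add_zero, abs_zero]
        ring
      · simp only [h, zero_add, abs_mul, abs_neg, abs_one, one_mul, abs_of_nonneg (hp₂ x),
          abs_zero]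
        ring
    simp only [this]
    rw [integral_sub i₁ i₂, e₁, e₂, sub_self]
  · have : ∀ x, ‖g₁ x + (-1 : ℝ) • g₂ x‖ ^ 2 = ‖g₁ x‖ ^ 2 + ‖g₂ x‖ ^ 2 := fun x => by
      rcases hcases x with ⟨-, h⟩ | ⟨-, h⟩ <;> simp [h]
    simp only [this]
    rw [integral_add k₁ k₂, f₁, f₂, two_mul]

/-! ### The three variational problems, in general and for balls -/

theorem HasTestApprox.rayleigh_eq {Ω : Set (E n)} (hΩ : IsOpen Ω) {u : E n → ℝ} {g : E n → E n}
    (h : HasTestApprox Ω u g) :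
    rayleigh Ω u = (∫ x in Ω, ‖g x‖ ^ 2) / ∫ x in Ω, |u x| ^ 2 := by
  rw [rayleigh, h.integral_norm_weakGradient hΩ]

theorem Q_eq_rayleigh_add (Ω : Set (E n)) (α : ℝ) (v : E n → ℝ) :
    Q Ω α v = rayleigh Ω v + α * (|∫ x in Ω, |v x| * v x| / ∫ x in Ω, |v x| ^ 2) := by
  rw [Q, rayleigh, add_div, mul_div_assoc]

theorem Q_of_mem_admissibleTwisted {Ω : Set (E n)} {v : E n → ℝ} (hv : v ∈ admissibleTwisted Ω)
    (α : ℝ) : Q Ω α v = rayleigh Ω v := by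
  rw [Q_eq_rayleigh_add, hv.2]
  simp

/-- The solution of the three variational problems in a bounded open set with a nonnegative first
eigenfunction. -/
theorem variational_problems {Ω : Set (E n)} (hΩ : IsOpen Ω) (hb : Bornology.IsBounded Ω) {l : ℝ}
    (hl : ∀ φ, IsTestFunction Ω φ → l * ∫ x in Ω, |φ x| ^ 2 ≤ ∫ x in Ω, ‖∇ φ x‖ ^ 2)
    {u : E n → ℝ} {g : E n → E n} (hu : HasTestApprox Ω u g) (hu0 : ∀ x, 0 ≤ u x)
    (hu1 : ∫ x in Ω, |u x| ^ 2 = 1) (hg : ∫ x in Ω, ‖g x‖ ^ 2 = l)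
    (hne : (admissibleTwisted Ω).Nonempty) :
    IsLambdaDeltaMinimizer Ω u ∧ lambdaDelta Ω = l ∧ l ≤ lambdaT Ω ∧
      (∃ v, IsLambdaTMinimizer Ω v) ∧
      ∀ α : ℝ, (∃ v, IsMuMinimizer Ω α v) ∧
        mu Ω α = if α ≤ lambdaT Ω - l then l + α else lambdaT Ω := by
  have hfin : volume Ω ≠ ⊤ := hb.measure_lt_top.ne
  have hu_mem : u ∈ admissible Ω := hu.mem_admissible hΩ (by rw [hu1]; exact one_pos)
  have hu_ray : rayleigh Ω u = l := by rw [hu.rayleigh_eq hΩ, hu1, hg, div_one]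
  have h1 : ∀ v g', HasTestApprox Ω v g' → l * ∫ x in Ω, |v x| ^ 2 ≤ ∫ x in Ω, ‖g' x‖ ^ 2 := by
    intro v g' hv
    simpa using hv.le_of_forall_isTestFunction (m := l) (α := 0) (by simpa using hl)
  have hmin : ∀ v ∈ admissible Ω, l ≤ rayleigh Ω v := fun v hv =>
    (le_div_iff₀ (integral_abs_sq_pos_of_mem hv)).2 (h1 v _ hv.1.hasTestApprox)
  obtain ⟨v, hv⟩ := exists_isLambdaTMinimizer hΩ hfin hne
  have hvT : rayleigh Ω v = lambdaT Ω :=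
    (show IsLeast (rayleigh Ω '' admissibleTwisted Ω) (rayleigh Ω v) from
      ⟨⟨v, hv.1, rfl⟩, by rintro _ ⟨w, hw, rfl⟩; exact hv.2 w hw⟩).csInf_eq.symm
  have hlT : l ≤ lambdaT Ω := hvT ▸ hmin v hv.1.1
  have hΔ : lambdaDelta Ω = l := IsLeast.csInf_eq
    ⟨⟨u, hu_mem, hu_ray⟩, by rintro _ ⟨w, hw, rfl⟩; exact hmin w hw⟩
  refine ⟨⟨hu_mem, fun w hw => hu_ray ▸ hmin w hw⟩, hΔ, hlT, ⟨v, hv⟩, fun α => ?_⟩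
  have h2 : ∀ w g', HasTestApprox Ω w g' → ∫ x in Ω, |w x| * w x = 0 →
      lambdaT Ω * ∫ x in Ω, |w x| ^ 2 ≤ ∫ x in Ω, ‖g' x‖ ^ 2 := by
    intro w g' hw h0
    have hnn : 0 ≤ ∫ x in Ω, |w x| ^ 2 := integral_nonneg fun x => by positivity
    rcases hnn.eq_or_lt with hz | hz
    · rw [← hz, mul_zero]
      exact integral_nonneg fun x => by positivity
    · rw [← le_div_iff₀ hz, ← hw.rayleigh_eq hΩ, ← hvT]
      exact hv.2 w ⟨hw.mem_admissible hΩ hz, h0⟩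
  have hQ : ∀ m, m ≤ l + α → m ≤ lambdaT Ω → ∀ w ∈ admissible Ω, m ≤ Q Ω α w := by
    intro m hm1 hm2 w hw
    exact (le_div_iff₀ (integral_abs_sq_pos_of_mem hw)).2
      (hw.1.hasTestApprox.le_of_forall_isTestFunction
        fun φ hφ => hφ.le_dirichlet_add hΩ hb h1 h2 hm1 hm2)
  -- An admissible function whose quotient lies below both `l + α` and `λ_T` is a minimizer: `u`
  -- qualifies for small `α`, `v` for large `α`.
  have hconc : ∀ w ∈ admissible Ω, ∀ m, Q Ω α w = m → m ≤ l + α → m ≤ lambdaT Ω →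
      (∃ v, IsMuMinimizer Ω α v) ∧ mu Ω α = m := by
    intro w hw m hm hm1 hm2
    refine ⟨⟨w, hw, fun w' hw' => hm ▸ hQ m hm1 hm2 w' hw'⟩, IsLeast.csInf_eq
      ⟨⟨w, hw, hm⟩, ?_⟩⟩
    rintro _ ⟨w', hw', rfl⟩
    exact hQ m hm1 hm2 w' hw'
  split_ifs with hα
  · refine hconc u hu_mem _ ?_ le_rfl (by linarith)
    have : ∫ x in Ω, |u x| * u x = 1 := by
      rw [← hu1]
      exact integral_congr_ae (ae_of_all _ fun x => by
        simp only [abs_of_nonneg (hu0 x), sq])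
    rw [Q_eq_rayleigh_add, this, hu1, hu_ray]
    simp
  · exact hconc v hv.1.1 _ (by rw [Q_of_mem_admissibleTwisted hv.1, hvT])
      (by linarith [not_le.1 hα]) le_rfl

/-- A ball contains two disjoint balls of equal radii. -/
theorem exists_two_disjoint_balls (hn : 2 ≤ n) (x₀ : E n) {R : ℝ} (hR : 0 < R) :
    ∃ y₁ y₂ : E n, Disjoint (Metric.ball y₁ (R / 2)) (Metric.ball y₂ (R / 2)) ∧
      Metric.ball y₁ (R / 2) ⊆ Metric.ball x₀ R ∧ Metric.ball y₂ (R / 2) ⊆ Metric.ball x₀ R := by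
  set e : E n := EuclideanSpace.single ⟨0, by omega⟩ (1 : ℝ) with he
  have hnorm : ‖e‖ = 1 := by simp [he]
  have hsub : ∀ s : ℝ, |s| = R / 2 → Metric.ball (x₀ + s • e) (R / 2) ⊆ Metric.ball x₀ R := by
    intro s hs
    refine Metric.ball_subset_ball' ?_
    rw [dist_eq_norm, add_sub_cancel_left, norm_smul, hnorm, Real.norm_eq_abs, hs]
    linarith
  have habs : |R / 2| = R / 2 := abs_of_pos (by positivity)
  refine ⟨x₀ + (R / 2) • e, x₀ + (-(R / 2)) • e, Metric.ball_disjoint_ball ?_,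
    hsub _ habs, hsub _ (by rw [abs_neg, habs])⟩
  rw [dist_eq_norm, add_sub_add_left_eq_sub, ← sub_smul, norm_smul, hnorm, Real.norm_eq_abs,
    mul_one, sub_neg_eq_add, add_halves, abs_of_pos hR]

/-- The difference of the eigenfunctions of two half-sized balls is a competitor. Without one,
`lambdaT` would be the default infimum `0` of the empty set. -/
theorem admissibleTwisted_nonempty_of_ball_subset (hn : 2 ≤ n) {ν j : ℝ} (hν : 0 ≤ ν)
    (hνn : ν = n / 2 - 1) (hj : IsLeast (besselZeros ν) j) {Ω : Set (E n)} (hΩ : IsOpen Ω)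
    {x₀ : E n} {R : ℝ} (hR : 0 < R) (hsub : Metric.ball x₀ R ⊆ Ω) :
    (admissibleTwisted Ω).Nonempty := by
  obtain ⟨y₁, y₂, hd, h₁, h₂⟩ := exists_two_disjoint_balls hn x₀ hR
  obtain ⟨v, g, hv, hv2, hv0, -⟩ := exists_twisted_eigenfunction hν hνn hj (half_pos hR) hd
    hΩ.measurableSet (h₁.trans hsub) (h₂.trans hsub)
  exact ⟨v, hv.mem_admissible hΩ (by rw [hv2]; exact two_pos), hv0⟩

/-- The variational problems in a union of one or two disjoint balls, where `B₁` is the larger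
one and `c` assigns to each point the center of its ball. -/
theorem variational_problems_of_balls (hn : 2 ≤ n) {ν j : ℝ} (hν : 0 ≤ ν)
    (hνn : ν = n / 2 - 1) (hj : IsLeast (besselZeros ν) j) {Ω : Set (E n)} (hΩ : IsOpen Ω)
    (hb : Bornology.IsBounded Ω) {x₁ : E n} {R₁ : ℝ} (hR : 0 < R₁)
    (hsub : Metric.ball x₁ R₁ ⊆ Ω) {c : E n → E n} (hc : ∀ x ∈ Ω, ∀ᶠ y in 𝓝 x, c y = c x)
    (hcR : ∀ x ∈ Ω, ‖x - c x‖ < R₁) :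
    (∃ u, IsLambdaDeltaMinimizer Ω u) ∧ lambdaDelta Ω = j ^ 2 / R₁ ^ 2 ∧
      j ^ 2 / R₁ ^ 2 ≤ lambdaT Ω ∧ (∃ v, IsLambdaTMinimizer Ω v) ∧
      ∀ α : ℝ, (∃ v, IsMuMinimizer Ω α v) ∧
        mu Ω α = if α ≤ lambdaT Ω - j ^ 2 / R₁ ^ 2 then j ^ 2 / R₁ ^ 2 + α else lambdaT Ω := by
  obtain ⟨u, g, ha, hp, hu, hg, hn1, hl⟩ := exists_ball_eigenfunction hν hνn hj x₁ hR
  have hm := ha.mono measurableSet_ball hsub hu hg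
  have e₁ : ∫ x in Ω, |u x| ^ 2 = 1 := by
    rw [← hn1]
    exact setIntegral_eq_of_subset_of_forall_sdiff_eq_zero hΩ.measurableSet hsub
      fun x hx => by simp [hu x hx.2]
  have f₁ : ∫ x in Ω, ‖g x‖ ^ 2 = j ^ 2 / R₁ ^ 2 := by
    rw [← hl]
    exact setIntegral_eq_of_subset_of_forall_sdiff_eq_zero hΩ.measurableSet hsub
      fun x hx => by simp [hg x hx.2]
  have hj0 : 0 < j := hj.1.1
  obtain ⟨h1, h2, h3, h4, h5⟩ := variational_problems hΩ hb (l := j ^ 2 / R₁ ^ 2)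
    -- Every point of `Ω` is closer than `R₁` to its center, so the argument stays below `j²/4` in
    -- the smaller ball as well.
    (fun φ hφ => hφ.le_of_besselSeries_pos hν hνn hc fun x hx =>
      (besselSeries_firstBesselZero hν hj).2 _ (by positivity) (by
        have e : j ^ 2 / R₁ ^ 2 / 4 * R₁ ^ 2 = j ^ 2 / 4 := by field_simp
        rw [← e]
        have := hcR x hx
        gcongr)) hm hp e₁ f₁
    (admissibleTwisted_nonempty_of_ball_subset hn hν hνn hj hΩ hR hsub)
  exact ⟨⟨u, h1⟩, h2, h3, h4, h5⟩

/-- The center of the ball that contains a given point, for two disjoint balls, is a locally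
constant function. -/
theorem exists_locally_constant_center {x₁ x₂ : E n} {R₁ R₂ : ℝ} (hR : R₂ ≤ R₁)
    (hdisj : Disjoint (Metric.ball x₁ R₁) (Metric.ball x₂ R₂)) :
    ∃ c : E n → E n, ∀ x ∈ Metric.ball x₁ R₁ ∪ Metric.ball x₂ R₂,
      (∀ᶠ y in 𝓝 x, c y = c x) ∧ ‖x - c x‖ < R₁ := by
  classical
  refine ⟨fun x => if x ∈ Metric.ball x₁ R₁ then x₁ else x₂, fun x hx => ?_⟩
  by_cases h : x ∈ Metric.ball x₁ R₁
  · refine ⟨?_, by simpa only [if_pos h] using mem_ball_iff_norm.1 h⟩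
    filter_upwards [Metric.isOpen_ball.mem_nhds h] with y hy
    rw [if_pos hy, if_pos h]
  · have h' : x ∈ Metric.ball x₂ R₂ := hx.resolve_left h
    refine ⟨?_, by simpa only [if_neg h] using (mem_ball_iff_norm.1 h').trans_le hR⟩
    filter_upwards [Metric.isOpen_ball.mem_nhds h'] with y hy
    rw [if_neg (disjoint_right.1 hdisj hy), if_neg h]

/-- By scaling `|Ω| = 2 ω_n R^n`, so `|Ω|^(2/n) = (2 ω_n)^(2/n) R²`. -/
theorem rpow_volume_two_balls (hn : 2 ≤ n) {x₁ x₂ : E n} {R : ℝ} (hR : 0 < R)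
    (hdisj : Disjoint (Metric.ball x₁ R) (Metric.ball x₂ R)) (j : ℝ) :
    (2 : ℝ) ^ (2 / (n : ℝ)) * volume.real (Metric.ball (0 : E n) 1) ^ (2 / (n : ℝ)) * j ^ 2
      / volume.real (Metric.ball x₁ R ∪ Metric.ball x₂ R) ^ (2 / (n : ℝ)) = j ^ 2 / R ^ 2 := by
  have hn0 : (n : ℝ) ≠ 0 := by positivity
  have hV : 0 < volume.real (Metric.ball (0 : E n) 1) :=
    ENNReal.toReal_pos (Metric.measure_ball_pos volume _ one_pos).ne' measure_ball_lt_top.ne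
  have hball : ∀ x : E n, volume.real (Metric.ball x R) =
      R ^ n * volume.real (Metric.ball (0 : E n) 1) := by
    intro x
    rw [measureReal_def, Measure.addHaar_ball_of_pos volume x hR, ENNReal.toReal_mul,
      ENNReal.toReal_ofReal (by positivity), finrank_euclideanSpace_fin, measureReal_def]
  rw [measureReal_union hdisj measurableSet_ball, hball, hball]
  set V := volume.real (Metric.ball (0 : E n) 1)
  have e : (R ^ n * V + R ^ n * V) ^ (2 / (n : ℝ)) =
      2 ^ (2 / (n : ℝ)) * V ^ (2 / (n : ℝ)) * R ^ 2 := by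
    rw [show R ^ n * V + R ^ n * V = 2 * V * R ^ n by ring,
      Real.mul_rpow (by positivity) (by positivity), Real.mul_rpow (by positivity) hV.le,
      ← Real.rpow_natCast, ← Real.rpow_mul hR.le, mul_div_cancel₀ _ hn0]
    norm_num
  rw [e]
  have h1 : (0 : ℝ) < 2 ^ (2 / (n : ℝ)) := by positivity
  have h2 : 0 < V ^ (2 / (n : ℝ)) := by positivity
  field_simp

end TwistedEigen

end

/-! ### The main theorem -/

open TwistedEigen in
theorem mainTheorem4 (n : ℕ) (hn : 2 ≤ n) (j : ℝ) (hj : j = firstBesselZero ((n : ℝ) / 2 - 1)) :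
    -- `j = j_{n/2-1,1}` is indeed the least positive zero of the Bessel function
    IsLeast (besselZeros ((n : ℝ) / 2 - 1)) j ∧
    -- one ball
    (∀ (x₁ : E n) (R₁ : ℝ), 0 < R₁ → ∀ Ω : Set (E n), Ω = Metric.ball x₁ R₁ →
      (∃ u, IsLambdaTMinimizer Ω u) ∧
      ∀ α : ℝ, (∃ u, IsMuMinimizer Ω α u) ∧
        mu Ω α = if α ≤ lambdaT Ω - j ^ 2 / R₁ ^ 2 then j ^ 2 / R₁ ^ 2 + α else lambdaT Ω) ∧
    -- two disjoint balls
    (∀ (x₁ x₂ : E n) (R₁ R₂ : ℝ), R₂ ≤ R₁ → 0 < R₂ →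
      Disjoint (Metric.ball x₁ R₁) (Metric.ball x₂ R₂) →
      ∀ Ω : Set (E n), Ω = Metric.ball x₁ R₁ ∪ Metric.ball x₂ R₂ →
      (∃ u, IsLambdaTMinimizer Ω u) ∧
      ∀ α : ℝ, (∃ u, IsMuMinimizer Ω α u) ∧
        mu Ω α = if α ≤ lambdaT Ω - j ^ 2 / R₁ ^ 2 then j ^ 2 / R₁ ^ 2 + α else lambdaT Ω) ∧
    -- two disjoint balls of equal radii
    (∀ (x₁ x₂ : E n) (R : ℝ), 0 < R →
      Disjoint (Metric.ball x₁ R) (Metric.ball x₂ R) →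
      ∀ Ω : Set (E n), Ω = Metric.ball x₁ R ∪ Metric.ball x₂ R →
      (∃ u, IsLambdaDeltaMinimizer Ω u) ∧
      (∀ α : ℝ, 0 ≤ α →
        mu Ω α = lambdaT Ω ∧
        lambdaT Ω = lambdaDelta Ω ∧
        lambdaDelta Ω =
          (2 : ℝ) ^ (2 / (n : ℝ)) * volume.real (Metric.ball (0 : E n) 1) ^ (2 / (n : ℝ)) * j ^ 2
            / volume.real Ω ^ (2 / (n : ℝ))) ∧
      (∀ α : ℝ, 0 < α → ∀ u, IsMuMinimizer Ω α u → IsLambdaTMinimizer Ω u)) := by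
  have hν : (0 : ℝ) ≤ (n : ℝ) / 2 - 1 := by
    have : (2 : ℝ) ≤ n := by exact_mod_cast hn
    linarith
  have hleast : IsLeast (besselZeros ((n : ℝ) / 2 - 1)) j :=
    hj ▸ isLeast_firstBesselZero hν (besselZeros_nonempty hν rfl)
  have htwo : ∀ (x₁ x₂ : E n) (R₁ R₂ : ℝ), R₂ ≤ R₁ → 0 < R₂ →
      Disjoint (Metric.ball x₁ R₁) (Metric.ball x₂ R₂) → _ := fun x₁ x₂ R₁ R₂ hR hR₂ hd =>
    (exists_locally_constant_center hR hd).elim fun c hc =>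
      variational_problems_of_balls hn hν rfl hleast
        (Metric.isOpen_ball.union Metric.isOpen_ball)
        (Metric.isBounded_ball.union Metric.isBounded_ball) (hR₂.trans_le hR)
        (subset_union_left (t := Metric.ball x₂ R₂)) (fun x hx => (hc x hx).1)
        fun x hx => (hc x hx).2
  refine ⟨hleast, ?_, ?_, ?_⟩
  · rintro x₁ R₁ hR Ω rfl
    exact (variational_problems_of_balls hn hν rfl hleast Metric.isOpen_ball
      Metric.isBounded_ball hR Subset.rfl (c := fun _ => x₁)
      (fun _ _ => Eventually.of_forall fun _ => rfl) fun x hx => mem_ball_iff_norm.1 hx).2.2.2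
  · rintro x₁ x₂ R₁ R₂ hR hR₂ hd Ω rfl
    exact (htwo x₁ x₂ R₁ R₂ hR hR₂ hd).2.2.2
  · rintro x₁ x₂ R hR hd Ω rfl
    obtain ⟨hΔmin, hΔ, hlT, -, hmu⟩ := htwo x₁ x₂ R R le_rfl hR hd
    set Ω := Metric.ball x₁ R ∪ Metric.ball x₂ R
    have hΩ : IsOpen Ω := Metric.isOpen_ball.union Metric.isOpen_ball
    -- The difference of the two eigenfunctions lowers `λ_T` to the first eigenvalue.
    have hT : lambdaT Ω = j ^ 2 / R ^ 2 := by
      refine le_antisymm ?_ hlT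
      obtain ⟨v, g, hv, hv2, hv0, hvg⟩ := exists_twisted_eigenfunction hν rfl hleast hR hd
        hΩ.measurableSet subset_union_left subset_union_right
      have hray : rayleigh Ω v = j ^ 2 / R ^ 2 := by
        rw [hv.rayleigh_eq hΩ, hvg, hv2, mul_div_cancel_left₀ _ two_ne_zero]
      exact csInf_le (bddBelow_rayleigh _)
        ⟨v, ⟨hv.mem_admissible hΩ (by rw [hv2]; exact two_pos), hv0⟩, hray⟩
    have hmu' : ∀ α : ℝ, 0 ≤ α → mu Ω α = lambdaT Ω := by
      intro α hα
      rw [(hmu α).2, hT, sub_self]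
      split_ifs with h
      -- The threshold is `0` here, so the first case only contains `α = 0`.
      · rw [le_antisymm h hα, add_zero]
      · rfl
    refine ⟨hΔmin, fun α hα => ⟨hmu' α hα, hT.trans hΔ.symm, ?_⟩, fun α hα u hu => ?_⟩
    · rw [hΔ]
      exact (rpow_volume_two_balls hn hR hd j).symm
    · have hQu : Q Ω α u = lambdaT Ω := by
        rw [← hmu' α hα.le]
        exact (show IsLeast (Q Ω α '' admissible Ω) (Q Ω α u) from
          ⟨⟨u, hu.1, rfl⟩, by rintro _ ⟨w, hw, rfl⟩; exact hu.2 w hw⟩).csInf_eq.symm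
      have hge : lambdaT Ω ≤ rayleigh Ω u := by
        rw [hT, ← hΔ]
        exact csInf_le (bddBelow_rayleigh _) ⟨u, hu.1, rfl⟩
      have hpos := integral_abs_sq_pos_of_mem hu.1
      -- Since `λ_T = λ_Δ`, the gradient part alone is at least `μ`; a nonzero nonlocal term with `α
      -- > 0` would push `Q` above the minimum.
      have h0 : ∫ x in Ω, |u x| * u x = 0 := by
        by_contra hne
        have : 0 < α * (|∫ x in Ω, |u x| * u x| / ∫ x in Ω, |u x| ^ 2) := by
          have := abs_pos.2 hne
          positivity
        rw [Q_eq_rayleigh_add] at hQu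
        linarith
      have hmem : u ∈ admissibleTwisted Ω := ⟨hu.1, h0⟩
      refine ⟨hmem, fun v hv => ?_⟩
      rw [← Q_of_mem_admissibleTwisted hmem α, ← Q_of_mem_admissibleTwisted hv α]
      exact hu.2 v hv.1
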